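/- Notation. For a $d\times d$ complex matrix $L$ with Frobenius norm $\|L\|_2=1$, let $\mathcal L(\rho)=L\rho L^\dagger-\tfrac12\{L^\dagger L,\rho\}$, let $|\Gamma\rangle=\sum_{i=1}^d|i\rangle|i\rangle$, $|L\rangle=(L\otimes I)|\Gamma\rangle$, and let $\pi_L=|L\rangle\langle L|$ be its program state. Let $\|\cdot\|_\infty$ be the operator norm, $\|\cdot\|_1$ the trace norm, and let $\tfrac12\|\mathcal N-\mathcal M\|_\diamond=\tfrac12\sup_\rho\|(\mathcal I_R\otimes\mathcal N)(\rho)-(\mathcal I_R\otimes\mathcal M)(\rho)\|_1$ be the normalized diamond distance, where $\rho$ ranges over states on $R\otimes\mathbb C^d$ and $R$ over finite-dimensional reference systems. For a random $L$: - the typical sample complexity $\overline n_d(t,\varepsilon,\delta)\in\mathbb N\cup\{\infty\}$ is the least $n\in\mathbb N$ for which there is a completely positive trace-preserving map $\mathcal P^{(n)}$, not depending on $L$, such that $\tfrac12\|\mathcal P^{(n)}\circ\mathcal A_{\pi_L^{\otimes n}}-e^{\mathcal Lt}\|_\diamond\le\varepsilon$ with probability at least $1-\delta$, where $\mathcal A_{\kappa}(\zeta)=\zeta\otimes\kappa$;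 - the typical WML sample complexity $\overline n_d^{\mathrm{WML}}(t,\varepsilon,\delta)\in\mathbb N\cup\{\infty\}$ is the least $n\in\mathbb N$ such that $\tfrac12\|(\widetilde{e^{\mathcal Lt/n}})^n-e^{\mathcal Lt}\|_\diamond\le\varepsilon$ with probability at least $1-\delta$ (for $n=0$ the algorithm is the identity channel). Here $\widetilde{e^{\mathcal L\Delta}}(\rho)=\operatorname{Tr}_{23}[e^{\mathcal M\Delta}(\rho\otimes\pi_L)]$ is one step of wave matrix Lindbladization (WML), with $\mathcal M(\omega)=M\omega M^\dagger-\tfrac12\{M^\dagger M,\omega\}$ and $M=\tfrac1{\sqrt d}(I_1\otimes|\Gamma\rangle\langle\Gamma|_{23})(\mathrm{SWAP}_{12}\otimes I_3)$. The subgaussian norm of a complex random variable $X$ is $\|X\|_{\psi_2}=\inf\{s>0:\mathbb E\,e^{|X|^2/s^2}\le2\}$. Theorem. For every $K$ there is a constant $C_K>0$, depending only on $K$, such that the following holds. Let $d\ge2$, let $L'$ be a random $d\times d$ complex matrix whose entries are independent with $\mathbb E L'_{ij}=0$, $\mathbb E|L'_{ij}|^2=1$ and $\|L'_{ij}\|_{\psi_2}\le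 K$, and let $L=L'/\|L'\|_2$ (on the event $L'=0$, where the quotient is undefined, $L$ may be any random matrix with $\|L\|_2=1$). Then for every $\delta\in(0,1)$, with probability at least $1-\delta$, $$\|L\|_\infty^2\le C_K\left(\frac1d+\frac{\log(1/\delta)}{d^2}\right),$$ and for all $t\ge0$ and $\varepsilon\in(0,1)$, both $\overline n_d(t,\varepsilon,\delta)$ and $\overline n_d^{\mathrm{WML}}(t,\varepsilon,\delta)$ are at most $$\left\lceil C_K\,\frac{t^2}{\varepsilon}\left(1+\frac{\log(1/\delta)}{d}\right)\right\rceil .$$ In particular, both are $O(t^2/\varepsilon)$ for fixed $K$ and $\delta$ as $d$ increases: for every $\delta\in(0,1)$ there is $d_0$ such that for all $d\ge\max(2,d_0)$, all such $L'$ and $L$, and all $t\ge0$, $\varepsilon\in(0,1)$, both are at most $\lceil C_K\,t^2/\varepsilon\rceil$. -/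

import Mathlib

open MeasureTheory ProbabilityTheory
open scoped ENNReal Matrix Kronecker ComplexOrder

namespace WML

section Norms

variable {n : Type*} [Fintype n] [DecidableEq n]

/-- The Frobenius (Schatten 2-) norm. -/
noncomputable def frobNorm (A : Matrix n n ℂ) : ℝ :=
  Real.sqrt (∑ i, ∑ j, ‖A i j‖ ^ 2)

/-- The operator norm `‖A‖_∞`, i.e. the norm of `A` as an operator on the Euclidean space. -/
noncomputable def opNorm (A : Matrix n n ℂ) : ℝ :=
  ‖Matrix.toEuclideanCLM (n := n) (𝕜 := ℂ) A‖

/-- The trace norm `‖A‖₁ = Tr √(A Aᴴ)`, the sum of the square roots of the eigenvalues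
of `A Aᴴ`. -/
noncomputable def traceNorm (A : Matrix n n ℂ) : ℝ :=
  ∑ i, Real.sqrt ((Matrix.isHermitian_mul_conjTranspose_self A).eigenvalues i)

end Norms

section Channels

variable {a b : Type*}

/-- Density matrices. -/
def IsState [Fintype a] (ρ : Matrix a a ℂ) : Prop :=
  ρ.PosSemidef ∧ ρ.trace = 1

/-- `(ℐ_r ⊗ Φ)(X)` for a reference system with index set `r`: the map `Φ` is applied to each of
the blocks of `X`. -/
def ampliate (r : Type*) (Φ : Matrix a a ℂ →ₗ[ℂ] Matrix b b ℂ) (X : Matrix (r × a) (r × a) ℂ) :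
    Matrix (r × b) (r × b) ℂ :=
  Matrix.of fun p q => Φ (Matrix.of fun i j => X (p.1, i) (q.1, j)) p.2 q.2

/-- Completely positive and trace-preserving maps. -/
def IsCPTP [Fintype a] [Fintype b] (Φ : Matrix a a ℂ →ₗ[ℂ] Matrix b b ℂ) : Prop :=
  (∀ (k : ℕ) (X : Matrix (Fin k × a) (Fin k × a) ℂ),
      X.PosSemidef → (ampliate (Fin k) Φ X).PosSemidef) ∧
    ∀ X : Matrix a a ℂ, (Φ X).trace = X.trace

/-- The normalized diamond distance `½ ‖Φ - Ψ‖_⋄`: half of the supremum, over reference systems of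
arbitrary finite dimension `k` and over the joint states `ρ`, of
`‖(ℐ ⊗ Φ)(ρ) - (ℐ ⊗ Ψ)(ρ)‖₁`. -/
noncomputable def diamondDist [Fintype a] [Fintype b] [DecidableEq b]
    (Φ Ψ : Matrix a a ℂ →ₗ[ℂ] Matrix b b ℂ) : ℝ≥0∞ :=
  (1 / 2) * ⨆ (k : ℕ) (ρ : Matrix (Fin k × a) (Fin k × a) ℂ) (_ : IsState ρ),
    ENNReal.ofReal (traceNorm (ampliate (Fin k) Φ ρ - ampliate (Fin k) Ψ ρ))

/-- The channel `ζ ↦ ζ ⊗ κ` that appends the system `b` in the state `κ`. -/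
def appendState (κ : Matrix b b ℂ) : Matrix a a ℂ →ₗ[ℂ] Matrix (a × b) (a × b) ℂ where
  toFun X := X ⊗ₖ κ
  map_add' X Y := Matrix.add_kronecker X Y κ
  map_smul' c X := Matrix.smul_kronecker c X κ

/-- The `n`-fold tensor power `κ^{⊗ n}`. -/
def tensorPower (κ : Matrix b b ℂ) (n : ℕ) : Matrix (Fin n → b) (Fin n → b) ℂ :=
  Matrix.of fun x y => ∏ i, κ (x i) (y i)

/-- The partial trace over the second factor. -/
def partialTraceRight (a b : Type*) [Fintype b] :
    Matrix (a × b) (a × b) ℂ →ₗ[ℂ] Matrix a a ℂ where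
  toFun X := Matrix.of fun i j => ∑ s, X (i, s) (j, s)
  map_add' X Y := by
    ext i j
    simp [Finset.sum_add_distrib]
  map_smul' c X := by
    ext i j
    simp [Finset.mul_sum]

variable [Fintype a] [DecidableEq a]

/-- The Lindblad generator `X ↦ J X Jᴴ - ½ {Jᴴ J, X}` with the single jump operator `J`. -/
noncomputable def lindblad (J : Matrix a a ℂ) : Module.End ℂ (Matrix a a ℂ) where
  toFun X := J * X * Jᴴ - (1 / 2 : ℂ) • (Jᴴ * J * X + X * (Jᴴ * J))
  map_add' X Y := by
    simp only [mul_add, add_mul, smul_add]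
    abel
  map_smul' c X := by
    simp only [Matrix.mul_smul, Matrix.smul_mul, smul_sub, smul_add, RingHom.id_apply,
      smul_comm c (1 / 2 : ℂ)]

/-- The semigroup `e^{t 𝒢}` generated by a superoperator `𝒢`. The exponential series is summed in
the algebra of `a² × a²` matrices, which is identified with the algebra of superoperators through
the basis of matrix units. -/
noncomputable def semigroup (𝒢 : Module.End ℂ (Matrix a a ℂ)) (t : ℝ) :
    Module.End ℂ (Matrix a a ℂ) :=
  Matrix.toLinAlgEquiv (Matrix.stdBasis ℂ a a)
    (NormedSpace.exp ((t : ℂ) • LinearMap.toMatrixAlgEquiv (Matrix.stdBasis ℂ a a) 𝒢))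

end Channels

section Algorithm

variable {d : ℕ}

/-- The unnormalized maximally entangled vector `|Γ⟩ = ∑ᵢ |i⟩|i⟩`. -/
def gammaVec (d : ℕ) : Fin d × Fin d → ℂ :=
  fun p => if p.1 = p.2 then 1 else 0

/-- The vectorization `|L⟩ = (L ⊗ I)|Γ⟩`. -/
def ket (L : Matrix (Fin d) (Fin d) ℂ) : Fin d × Fin d → ℂ :=
  (L ⊗ₖ (1 : Matrix (Fin d) (Fin d) ℂ)) *ᵥ gammaVec d

/-- The program state `π_L = |L⟩⟨L|`. -/
def programState (L : Matrix (Fin d) (Fin d) ℂ) :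
    Matrix (Fin d × Fin d) (Fin d × Fin d) ℂ :=
  Matrix.vecMulVec (ket L) (star (ket L))

/-- `SWAP₁₂ ⊗ I₃` on three `d`-dimensional systems. -/
def swap12 (d : ℕ) : Matrix (Fin d × Fin d × Fin d) (Fin d × Fin d × Fin d) ℂ :=
  Matrix.of fun p q => if p.1 = q.2.1 ∧ p.2.1 = q.1 ∧ p.2.2 = q.2.2 then 1 else 0

/-- The jump operator `M = d^{-1/2} (I₁ ⊗ |Γ⟩⟨Γ|₂₃) (SWAP₁₂ ⊗ I₃)`. -/
noncomputable def wmlJump (d : ℕ) :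
    Matrix (Fin d × Fin d × Fin d) (Fin d × Fin d × Fin d) ℂ :=
  ((1 / Real.sqrt d : ℝ) : ℂ) •
    (((1 : Matrix (Fin d) (Fin d) ℂ) ⊗ₖ Matrix.vecMulVec (gammaVec d) (star (gammaVec d))) *
      swap12 d)

/-- One step of wave matrix Lindbladization: `ρ ↦ Tr₂₃ [e^{ℳ Δ} (ρ ⊗ π_L)]`. -/
noncomputable def wmlStep (L : Matrix (Fin d) (Fin d) ℂ) (Δ : ℝ) :
    Module.End ℂ (Matrix (Fin d) (Fin d) ℂ) :=
  partialTraceRight (Fin d) (Fin d × Fin d) ∘ₗ semigroup (lindblad (wmlJump d)) Δ ∘ₗ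
    appendState (programState L)

variable {Ω : Type*} [MeasurableSpace Ω]

/-- The typical sample complexity of sample-based simulation of `e^{t ℒ}`, where `ℒ` is the
Lindbladian with the random jump operator `L`: the least number `n` of copies of the program state
for which some channel `P`, not depending on `L`, satisfies
`½ ‖P ∘ (ζ ↦ ζ ⊗ π_L^{⊗ n}) - e^{t ℒ}‖_⋄ ≤ ε` with probability at least `1 - δ`
(`⊤` if there is none). -/
noncomputable def typicalSampleComplexity (μ : Measure Ω) (L : Ω → Matrix (Fin d) (Fin d) ℂ)
    (t ε δ : ℝ) : ℕ∞ :=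
  ⨅ (n : ℕ) (_ : ∃ P : Matrix (Fin d × (Fin n → Fin d × Fin d))
        (Fin d × (Fin n → Fin d × Fin d)) ℂ →ₗ[ℂ] Matrix (Fin d) (Fin d) ℂ, IsCPTP P ∧
      ENNReal.ofReal (1 - δ) ≤ μ {ω | diamondDist
        (P ∘ₗ appendState (tensorPower (programState (L ω)) n))
        (semigroup (lindblad (L ω)) t) ≤ ENNReal.ofReal ε}), (n : ℕ∞)

/-- The typical sample complexity of wave matrix Lindbladization: the least `n` for which the
algorithm with `n` steps of length `t / n` has an error at most `ε` with probability at least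
`1 - δ` (`⊤` if there is none; no step at all is the identity channel). -/
noncomputable def typicalWMLComplexity (μ : Measure Ω) (L : Ω → Matrix (Fin d) (Fin d) ℂ)
    (t ε δ : ℝ) : ℕ∞ :=
  ⨅ (n : ℕ) (_ : ENNReal.ofReal (1 - δ) ≤ μ {ω | diamondDist
        (wmlStep (L ω) (t / n) ^ n)
        (semigroup (lindblad (L ω)) t) ≤ ENNReal.ofReal ε}), (n : ℕ∞)

end Algorithm

section Ensemble

variable {Ω : Type*} [MeasurableSpace Ω]

/-- The subgaussian norm `inf {s > 0 : 𝔼 exp (|X|² / s²) ≤ 2}` (`⊤` if there is no such `s`). -/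
noncomputable def psi2Norm (μ : Measure Ω) (X : Ω → ℂ) : ℝ≥0∞ :=
  ⨅ (s : ℝ) (_ : 0 < s ∧ ∫⁻ ω, ENNReal.ofReal (Real.exp (‖X ω‖ ^ 2 / s ^ 2)) ∂μ ≤ 2),
    ENNReal.ofReal s

/-- A random matrix with independent, mean-zero, unit-variance complex subgaussian entries, whose
subgaussian norms are at most `K`. -/
structure IsSubgaussianEnsemble {d : ℕ} (μ : Measure Ω) (L' : Ω → Matrix (Fin d) (Fin d) ℂ)
    (K : ℝ) : Prop where
  measurable : ∀ i j, Measurable fun ω => L' ω i j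
  indep : iIndepFun (fun (p : Fin d × Fin d) ω => L' ω p.1 p.2) μ
  mean_zero : ∀ i j, ∫ ω, L' ω i j ∂μ = 0
  unit_variance : ∀ i j, ∫ ω, ‖L' ω i j‖ ^ 2 ∂μ = 1
  subgaussian : ∀ i j, psi2Norm μ (fun ω => L' ω i j) ≤ ENNReal.ofReal K

/-- `L = L' / ‖L'‖₂`. On the event `L' = 0`, where the quotient is not defined, `L` may be any
normalized matrix. -/
structure IsNormalization {d : ℕ} (L' L : Ω → Matrix (Fin d) (Fin d) ℂ) : Prop where
  measurable : ∀ i j, Measurable fun ω => L ω i j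
  normalized : ∀ ω, frobNorm (L ω) = 1
  eq_div : ∀ ω, L' ω ≠ 0 → L ω = ((1 / frobNorm (L' ω) : ℝ) : ℂ) • L' ω

end Ensemble

end WML

/-!
A step of wave matrix Lindbladization (WML) of length `Δ` agrees with `e^{ℒΔ}` to first order in
`Δ`. Its error is therefore governed by a bound on the second derivatives of both maps, and the
dimension enters only through `d ‖L‖_∞²`, a quantity that is of order one for a typical `L`.

**The single step** (`diamondBound_wmlStep_sub`). Write `ρ ⊗ π_L = V ρ Vᴴ` with `V ψ = ψ ⊗ |L⟩`, let
`J` be the jump operator of `ℳ` and `G = JᴴJ`. Then `(J V)ᴴ (J V) = LᴴL`, and `G` is `d` times a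
projection, so `ℳ` has norm at most `2 d`. In `ℳ (V ρ Vᴴ)` the terms `J V ρ (J V)ᴴ` and
`d⁻¹ G V ρ (G V)ᴴ` have trace norm at most `‖L‖_∞²`, so another application of `ℳ` costs `d ‖L‖_∞²`.
What remains is the part of `V ρ Vᴴ` that is off-diagonal with respect to the projection `G / d`. It
is not small in trace norm, but `ℳ` multiplies it by `-d / 2` (`lindblad_offDiagonal`), so the
semigroup merely damps it, and its partial trace *is* of order `‖L‖_∞²`. Altogether the second
derivative of the error is at most `9 d ‖L‖_∞²` in diamond norm, and the errors of `n` steps of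
length `t / n` add up to `O(d ‖L‖_∞² t² / n)`, because Lindblad semigroups are channels
(`isCPTP_semigroup_lindblad`). Feeding the program states one by one into the steps turns the
algorithm into a single channel that does not depend on `L` (`iterateProgram`), so the bound holds
for the optimal sample complexity as well.

Trace norms are not handled through their definition by eigenvalues but through Jordan
decompositions `Z = P - N` with `tr P + tr N ≤ c` (`HasJordanBound`), which channels, sums and
polarized cross terms obviously respect, and, for Taylor's formula, through the dual description by
pairing with contractions (`hasJordanBound_of_forall_contraction`).

**Concentration** (`measure_opNorm_sq_le_ge`). For unit vectors `x`, `y` the form `⟨y, L' x⟩` is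
subgaussian, so a union bound over a net of `5^(2d)` vectors gives `‖L'‖_∞² = O(d + log (1/δ))`, and
a Chernoff bound gives `‖L'‖₂² ≥ d² / 2` up to a probability `exp (-c d²)`. If `δ` is smaller than
that, then `(d + log (1/δ)) / d²` is bounded below and the claim follows from `‖L‖_∞ ≤ ‖L‖₂ = 1`.
-/

namespace WML

/-! ### Trace norm and Jordan decompositions -/

section Matrices

variable {n : Type*} [Fintype n] [DecidableEq n]

open scoped MatrixOrder in
lemma re_trace_mul_nonneg {A B : Matrix n n ℂ} (hA : A.PosSemidef) (hB : B.PosSemidef) :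
    0 ≤ (A * B).trace.re := by
  obtain ⟨C, rfl⟩ := CStarAlgebra.nonneg_iff_eq_star_mul_self.mp hB.nonneg
  rw [← mul_assoc, Matrix.trace_mul_comm, ← mul_assoc]
  exact (Complex.le_def.1 (hA.mul_mul_conjTranspose_same C).trace_nonneg).1

/-- A contraction pairs with a positive semidefinite matrix to at most its trace: expand
`0 ≤ tr ((1 - W) P (1 - W)ᴴ)`. -/
lemma re_trace_contraction_mul_le {W P : Matrix n n ℂ} (hW : (1 - Wᴴ * W).PosSemidef)
    (hP : P.PosSemidef) : (W * P).trace.re ≤ P.trace.re := by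
  have h1 := (Complex.le_def.1 (hP.mul_mul_conjTranspose_same (1 - W)).trace_nonneg).1
  have h2 := re_trace_mul_nonneg hW hP
  have h3 : (P * Wᴴ).trace.re = (W * P).trace.re := by
    have : P * Wᴴ = (W * P)ᴴ := by rw [Matrix.conjTranspose_mul, hP.1.eq]
    rw [this, Matrix.trace_conjTranspose]
    simp
  have h4 : (W * P * Wᴴ).trace = (Wᴴ * W * P).trace := by
    rw [Matrix.trace_mul_comm, mul_assoc]
  have h5 : (1 - W) * P * (1 - W)ᴴ = P - W * P - P * Wᴴ + W * P * Wᴴ := by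
    simp only [Matrix.conjTranspose_sub, Matrix.conjTranspose_one]
    noncomm_ring
  rw [h5] at h1
  simp only [Matrix.trace_add, Matrix.trace_sub, h4, Complex.add_re, Complex.sub_re, sub_mul,
    one_mul, Complex.zero_re, h3] at h1 h2
  linarith

/-- `Z` is a difference of two positive semidefinite matrices whose traces add up to at most `c`.
For a Hermitian `Z` this says that its trace norm is at most `c`. -/
def HasJordanBound (Z : Matrix n n ℂ) (c : ℝ) : Prop :=
  ∃ P N : Matrix n n ℂ, P.PosSemidef ∧ N.PosSemidef ∧ Z = P - N ∧ P.trace.re + N.trace.re ≤ c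

lemma HasJordanBound.re_trace_mul_le {Z : Matrix n n ℂ} {c : ℝ} (h : HasJordanBound Z c)
    {W : Matrix n n ℂ} (hW : (1 - Wᴴ * W).PosSemidef) : (W * Z).trace.re ≤ c := by
  obtain ⟨P, N, hP, hN, rfl, hc⟩ := h
  have h1 := re_trace_contraction_mul_le hW hP
  have h2 := re_trace_contraction_mul_le (W := -W) (by simpa using hW) hN
  simp only [neg_mul, Matrix.trace_neg, Complex.neg_re] at h2
  simp only [mul_sub, Matrix.trace_sub, Complex.sub_re]
  linarith

lemma conj_diagonal_mul (U : Matrix.unitaryGroup n ℂ) (a b : n → ℂ) :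
    ((U : Matrix n n ℂ) * Matrix.diagonal a * (U : Matrix n n ℂ)ᴴ) *
      ((U : Matrix n n ℂ) * Matrix.diagonal b * (U : Matrix n n ℂ)ᴴ) =
    (U : Matrix n n ℂ) * Matrix.diagonal (fun i => a i * b i) * (U : Matrix n n ℂ)ᴴ := by
  have hU : (U : Matrix n n ℂ)ᴴ * (U : Matrix n n ℂ) = 1 :=
    Matrix.mem_unitaryGroup_iff'.1 U.2
  calc _ = (U : Matrix n n ℂ) * Matrix.diagonal a * ((U : Matrix n n ℂ)ᴴ * (U : Matrix n n ℂ)) *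
        Matrix.diagonal b * (U : Matrix n n ℂ)ᴴ := by simp only [mul_assoc]
    _ = _ := by
      rw [hU, mul_one, mul_assoc (U : Matrix n n ℂ), Matrix.diagonal_mul_diagonal]

lemma trace_conj_diagonal (U : Matrix.unitaryGroup n ℂ) (a : n → ℂ) :
    ((U : Matrix n n ℂ) * Matrix.diagonal a * (U : Matrix n n ℂ)ᴴ).trace = ∑ i, a i := by
  have hU : (U : Matrix n n ℂ)ᴴ * (U : Matrix n n ℂ) = 1 :=
    Matrix.mem_unitaryGroup_iff'.1 U.2
  rw [Matrix.trace_mul_comm, ← mul_assoc, hU, one_mul, Matrix.trace_diagonal]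

lemma conjTranspose_conj_diagonal (U : Matrix.unitaryGroup n ℂ) (a : n → ℝ) :
    ((U : Matrix n n ℂ) * Matrix.diagonal (fun i => (a i : ℂ)) * (U : Matrix n n ℂ)ᴴ)ᴴ =
      (U : Matrix n n ℂ) * Matrix.diagonal (fun i => (a i : ℂ)) * (U : Matrix n n ℂ)ᴴ := by
  simp only [Matrix.conjTranspose_mul, Matrix.conjTranspose_conjTranspose,
    Matrix.diagonal_conjTranspose, mul_assoc]
  congr 3
  ext i
  simp

lemma posSemidef_conj_diagonal (U : Matrix.unitaryGroup n ℂ) {a : n → ℝ} (ha : ∀ i, 0 ≤ a i) :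
    ((U : Matrix n n ℂ) * Matrix.diagonal (fun i => (a i : ℂ)) *
      (U : Matrix n n ℂ)ᴴ).PosSemidef :=
  Matrix.PosSemidef.mul_mul_conjTranspose_same
    (Matrix.PosSemidef.diagonal fun i => by simpa using ha i) _

lemma one_eq_conj_diagonal (U : Matrix.unitaryGroup n ℂ) :
    (1 : Matrix n n ℂ) =
      (U : Matrix n n ℂ) * Matrix.diagonal (fun _ => ((1 : ℝ) : ℂ)) * (U : Matrix n n ℂ)ᴴ := by
  have hU : (U : Matrix n n ℂ) * (U : Matrix n n ℂ)ᴴ = 1 := Matrix.mem_unitaryGroup_iff.1 U.2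
  simp [hU]

lemma eq_conj_diagonal {A : Matrix n n ℂ} (hA : A.IsHermitian) :
    A = (hA.eigenvectorUnitary : Matrix n n ℂ) *
      Matrix.diagonal (fun i => (hA.eigenvalues i : ℂ)) *
      (hA.eigenvectorUnitary : Matrix n n ℂ)ᴴ := by
  conv_lhs => rw [hA.spectral_theorem, Unitary.conjStarAlgAut_apply]
  rfl

/-- The trace norm is attained by pairing with the contraction `Zᴴ U D^{-1/2} Uᴴ`, where
`Z Zᴴ = U D Uᴴ`. -/
lemma exists_contraction_trace_eq_traceNorm (Z : Matrix n n ℂ) :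
    ∃ W : Matrix n n ℂ, (1 - Wᴴ * W).PosSemidef ∧ (W * Z).trace.re = traceNorm Z := by
  set hH := Matrix.isHermitian_mul_conjTranspose_self Z
  set U := hH.eigenvectorUnitary
  set l := hH.eigenvalues
  have hl0 : ∀ i, 0 ≤ l i := Matrix.eigenvalues_self_mul_conjTranspose_nonneg Z
  have hZ : Z * Zᴴ = (U : Matrix n n ℂ) * Matrix.diagonal (fun i => (l i : ℂ)) *
      (U : Matrix n n ℂ)ᴴ := eq_conj_diagonal hH
  -- `Real.sqrt 0` has the inverse `0`, so `S` is the pseudo-inverse of `√(Z Zᴴ)`.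
  set S : Matrix n n ℂ := (U : Matrix n n ℂ) *
    Matrix.diagonal (fun i => (((Real.sqrt (l i))⁻¹ : ℝ) : ℂ)) * (U : Matrix n n ℂ)ᴴ with hS
  have hSH : Sᴴ = S := conjTranspose_conj_diagonal U _
  refine ⟨Zᴴ * S, ?_, ?_⟩
  · have : (Zᴴ * S)ᴴ * (Zᴴ * S) = S * (Z * Zᴴ) * S := by
      simp only [Matrix.conjTranspose_mul, Matrix.conjTranspose_conjTranspose, hSH, mul_assoc]
    rw [this, hZ, hS, conj_diagonal_mul, conj_diagonal_mul]
    nth_rewrite 1 [one_eq_conj_diagonal U]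
    rw [← sub_mul, ← mul_sub, Matrix.diagonal_sub]
    have := posSemidef_conj_diagonal U
      (a := fun i => 1 - (Real.sqrt (l i))⁻¹ * l i * (Real.sqrt (l i))⁻¹) (fun i => by
        rcases (hl0 i).eq_or_lt with h | h
        · simp [← h]
        · have h1 : Real.sqrt (l i) ≠ 0 := (Real.sqrt_pos.2 h).ne'
          have : (Real.sqrt (l i))⁻¹ * l i * (Real.sqrt (l i))⁻¹ = 1 := by
            nth_rewrite 2 [← Real.mul_self_sqrt h.le]
            field_simp
          linarith)
    simpa only [Complex.ofReal_sub, Complex.ofReal_mul] using this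
  · rw [Matrix.trace_mul_comm, ← mul_assoc, hZ, hS, conj_diagonal_mul, trace_conj_diagonal]
    rw [Complex.re_sum, traceNorm]
    refine Finset.sum_congr rfl fun i _ => ?_
    rw [← Complex.ofReal_mul, Complex.ofReal_re, ← div_eq_mul_inv, Real.div_sqrt]

lemma HasJordanBound.traceNorm_le {Z : Matrix n n ℂ} {c : ℝ} (h : HasJordanBound Z c) :
    traceNorm Z ≤ c := by
  obtain ⟨W, hW, hWZ⟩ := exists_contraction_trace_eq_traceNorm Z
  exact hWZ ▸ h.re_trace_mul_le hW

/-- The converse of `HasJordanBound.re_trace_mul_le`: the Jordan decomposition is obtained by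
pairing with the sign of `Z`. -/
lemma hasJordanBound_of_forall_contraction {Z : Matrix n n ℂ} (hZ : Z.IsHermitian) {c : ℝ}
    (h : ∀ W : Matrix n n ℂ, (1 - Wᴴ * W).PosSemidef → (W * Z).trace.re ≤ c) :
    HasJordanBound Z c := by
  set U := hZ.eigenvectorUnitary
  set l := hZ.eigenvalues
  have hZe : Z = (U : Matrix n n ℂ) * Matrix.diagonal (fun i => (l i : ℂ)) *
      (U : Matrix n n ℂ)ᴴ := eq_conj_diagonal hZ
  refine ⟨_, _, posSemidef_conj_diagonal U (a := fun i => max (l i) 0) fun i => le_max_right _ _,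
    posSemidef_conj_diagonal U (a := fun i => max (-l i) 0) fun i => le_max_right _ _, ?_, ?_⟩
  · rw [← sub_mul, ← mul_sub, Matrix.diagonal_sub]
    conv_lhs => rw [hZe]
    congr 3
    ext i
    rw [← Complex.ofReal_sub]
    congr 1
    rcases le_total (l i) 0 with h | h <;> simp [h]
  · set s : n → ℝ := fun i => if 0 ≤ l i then 1 else -1 with hs
    have hs1 : ∀ i, s i * s i = 1 := fun i => by
      simp only [hs]
      split_ifs <;> norm_num
    set W := (U : Matrix n n ℂ) * Matrix.diagonal (fun i => (s i : ℂ)) * (U : Matrix n n ℂ)ᴴ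
      with hW
    have hWW : Wᴴ * W = 1 := by
      rw [hW, conjTranspose_conj_diagonal, conj_diagonal_mul, one_eq_conj_diagonal U]
      congr 3
      ext i
      rw [← Complex.ofReal_mul, hs1]
    have := h W (by rw [hWW, sub_self]; exact Matrix.PosSemidef.zero)
    rw [hW, hZe, conj_diagonal_mul, trace_conj_diagonal] at this
    rw [trace_conj_diagonal, trace_conj_diagonal, ← Complex.add_re, ← Finset.sum_add_distrib]
    refine le_trans (le_of_eq ?_) this
    rw [Complex.re_sum, Complex.re_sum]
    refine Finset.sum_congr rfl fun i _ => ?_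
    rw [← Complex.ofReal_mul, ← Complex.ofReal_add, Complex.ofReal_re, Complex.ofReal_re]
    simp only [hs]
    split_ifs with hi
    · simp [hi]
    · push Not at hi
      simp [hi.le]

end Matrices

section JordanBound

variable {n : Type*} [Fintype n]

lemma HasJordanBound.mono {Z : Matrix n n ℂ} {c c' : ℝ} (h : HasJordanBound Z c) (hc : c ≤ c') :
    HasJordanBound Z c' := by
  obtain ⟨P, N, hP, hN, hZ, h⟩ := h
  exact ⟨P, N, hP, hN, hZ, h.trans hc⟩

lemma HasJordanBound.add {Z Z' : Matrix n n ℂ} {c c' : ℝ} (h : HasJordanBound Z c)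
    (h' : HasJordanBound Z' c') : HasJordanBound (Z + Z') (c + c') := by
  obtain ⟨P, N, hP, hN, rfl, h⟩ := h
  obtain ⟨P', N', hP', hN', rfl, h'⟩ := h'
  refine ⟨P + P', N + N', hP.add hP', hN.add hN', by abel, ?_⟩
  simp only [Matrix.trace_add, Complex.add_re]
  linarith

lemma HasJordanBound.neg {Z : Matrix n n ℂ} {c : ℝ} (h : HasJordanBound Z c) :
    HasJordanBound (-Z) c := by
  obtain ⟨P, N, hP, hN, rfl, h⟩ := h
  exact ⟨N, P, hN, hP, by abel, by linarith⟩

lemma HasJordanBound.smul {Z : Matrix n n ℂ} {c : ℝ} (h : HasJordanBound Z c) (r : ℝ) :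
    HasJordanBound ((r : ℂ) • Z) (|r| * c) := by
  have key : ∀ r : ℝ, 0 ≤ r → HasJordanBound ((r : ℂ) • Z) (r * c) := fun r hr => by
    obtain ⟨P, N, hP, hN, rfl, h⟩ := h
    have hr' : (0 : ℂ) ≤ (r : ℂ) := by exact_mod_cast hr
    refine ⟨(r : ℂ) • P, (r : ℂ) • N, hP.smul hr', hN.smul hr', smul_sub _ _ _, ?_⟩
    simp only [Matrix.trace_smul, smul_eq_mul, Complex.re_ofReal_mul]
    nlinarith
  rcases le_total 0 r with hr | hr
  · rw [abs_of_nonneg hr]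
    exact key r hr
  · rw [abs_of_nonpos hr]
    simpa using (key (-r) (by linarith)).neg

end JordanBound

/-! ### Completely positive maps and the diamond norm -/

section Ampliation

variable {a b c r : Type*}

lemma ampliate_comp (Φ : Matrix b b ℂ →ₗ[ℂ] Matrix c c ℂ) (Ψ : Matrix a a ℂ →ₗ[ℂ] Matrix b b ℂ)
    (X : Matrix (r × a) (r × a) ℂ) :
    ampliate r (Φ ∘ₗ Ψ) X = ampliate r Φ (ampliate r Ψ X) := rfl

lemma ampliate_add_left (Φ Ψ : Matrix a a ℂ →ₗ[ℂ] Matrix b b ℂ) (X : Matrix (r × a) (r × a) ℂ) :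
    ampliate r (Φ + Ψ) X = ampliate r Φ X + ampliate r Ψ X := rfl

lemma ampliate_sub_left (Φ Ψ : Matrix a a ℂ →ₗ[ℂ] Matrix b b ℂ) (X : Matrix (r × a) (r × a) ℂ) :
    ampliate r (Φ - Ψ) X = ampliate r Φ X - ampliate r Ψ X := rfl

lemma ampliate_smul_left (z : ℂ) (Φ : Matrix a a ℂ →ₗ[ℂ] Matrix b b ℂ)
    (X : Matrix (r × a) (r × a) ℂ) : ampliate r (z • Φ) X = z • ampliate r Φ X := rfl

lemma ampliate_sub_right (Φ : Matrix a a ℂ →ₗ[ℂ] Matrix b b ℂ) (X Y : Matrix (r × a) (r × a) ℂ) :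
    ampliate r Φ (X - Y) = ampliate r Φ X - ampliate r Φ Y := by
  ext p q
  exact congrFun (congrFun (map_sub Φ (Matrix.of fun i j => X (p.1, i) (q.1, j))
    (Matrix.of fun i j => Y (p.1, i) (q.1, j))) p.2) q.2

/-- The linear map `X ↦ A X Bᴴ`. -/
noncomputable def sandwich [Fintype a] (A B : Matrix b a ℂ) :
    Matrix a a ℂ →ₗ[ℂ] Matrix b b ℂ where
  toFun X := A * X * Bᴴ
  map_add' X Y := by simp only [Matrix.mul_add, Matrix.add_mul]
  map_smul' z X := by simp only [Matrix.mul_smul, Matrix.smul_mul, RingHom.id_apply]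

lemma sandwich_apply [Fintype a] (A B : Matrix b a ℂ) (X : Matrix a a ℂ) :
    sandwich A B X = A * X * Bᴴ := rfl

lemma ampliate_sandwich_self [Fintype a] [Fintype r] [DecidableEq r] (A : Matrix b a ℂ)
    (X : Matrix (r × a) (r × a) ℂ) :
    ampliate r (sandwich A A) X =
      ((1 : Matrix r r ℂ) ⊗ₖ A) * X * ((1 : Matrix r r ℂ) ⊗ₖ A)ᴴ := by
  ext ⟨p, i⟩ ⟨q, j⟩
  change (A * Matrix.of (fun i j => X (p, i) (q, j)) * Aᴴ) i j = _
  simp only [Matrix.mul_apply, Fintype.sum_prod_type, Matrix.kroneckerMap_apply, Matrix.of_apply,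
    Matrix.one_apply, Matrix.conjTranspose_apply, ite_mul, one_mul, zero_mul]
  symm
  rw [Finset.sum_eq_single q (fun x _ hx => by simp [hx.symm]) (by simp)]
  simp [Finset.sum_ite_irrel]

/-- The partial trace of `X` over the reference system `r`. -/
def reducedState [Fintype r] (X : Matrix (r × a) (r × a) ℂ) : Matrix a a ℂ :=
  ∑ p, X.submatrix (fun i => (p, i)) (fun i => (p, i))

lemma posSemidef_reducedState [Fintype r] {X : Matrix (r × a) (r × a) ℂ} (hX : X.PosSemidef) :
    (reducedState X).PosSemidef :=
  Matrix.posSemidef_sum _ fun _ _ => hX.submatrix _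

lemma trace_ampliate [Fintype r] [Fintype b] (Φ : Matrix a a ℂ →ₗ[ℂ] Matrix b b ℂ)
    (X : Matrix (r × a) (r × a) ℂ) :
    (ampliate r Φ X).trace = (Φ (reducedState X)).trace := by
  rw [reducedState, map_sum, Matrix.trace_sum, Matrix.trace, Fintype.sum_prod_type]
  rfl

lemma trace_reducedState [Fintype r] [Fintype a] (X : Matrix (r × a) (r × a) ℂ) :
    (reducedState X).trace = X.trace := by
  rw [reducedState, Matrix.trace_sum, Matrix.trace, Fintype.sum_prod_type]
  rfl

end Ampliation

section CompletelyPositive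

variable {a b c : Type*}

/-- Completely positive maps, tested on the reference systems `Fin k`. -/
def IsCP (Φ : Matrix a a ℂ →ₗ[ℂ] Matrix b b ℂ) : Prop :=
  ∀ (k : ℕ) (X : Matrix (Fin k × a) (Fin k × a) ℂ), X.PosSemidef →
    (ampliate (Fin k) Φ X).PosSemidef

lemma IsCP.comp {Φ : Matrix b b ℂ →ₗ[ℂ] Matrix c c ℂ} {Ψ : Matrix a a ℂ →ₗ[ℂ] Matrix b b ℂ}
    (hΦ : IsCP Φ) (hΨ : IsCP Ψ) : IsCP (Φ ∘ₗ Ψ) := fun k _ hX => hΦ k _ (hΨ k _ hX)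

lemma IsCP.add {Φ Ψ : Matrix a a ℂ →ₗ[ℂ] Matrix b b ℂ} (hΦ : IsCP Φ) (hΨ : IsCP Ψ) :
    IsCP (Φ + Ψ) := fun k X hX => (hΦ k X hX).add (hΨ k X hX)

lemma isCP_zero : IsCP (0 : Matrix a a ℂ →ₗ[ℂ] Matrix b b ℂ) :=
  fun _ _ _ => Matrix.PosSemidef.zero

lemma isCP_sum {ι : Type*} (s : Finset ι) {Φ : ι → Matrix a a ℂ →ₗ[ℂ] Matrix b b ℂ}
    (h : ∀ i ∈ s, IsCP (Φ i)) : IsCP (∑ i ∈ s, Φ i) :=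
  Finset.sum_induction _ IsCP (fun _ _ => IsCP.add) isCP_zero h

lemma IsCP.smul {Φ : Matrix a a ℂ →ₗ[ℂ] Matrix b b ℂ} (hΦ : IsCP Φ) {x : ℝ} (hx : 0 ≤ x) :
    IsCP ((x : ℂ) • Φ) := fun k X hX =>
  (hΦ k X hX).smul (by exact_mod_cast hx : (0 : ℂ) ≤ (x : ℂ))

lemma isCP_id : IsCP (LinearMap.id : Matrix a a ℂ →ₗ[ℂ] Matrix a a ℂ) := fun _ _ hX => hX

lemma IsCP.pow {Φ : Module.End ℂ (Matrix a a ℂ)} (hΦ : IsCP Φ) (n : ℕ) : IsCP (Φ ^ n) := by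
  induction n with
  | zero => exact isCP_id
  | succ n ih =>
    rw [pow_succ]
    exact ih.comp hΦ

lemma isCP_sandwich [Fintype a] [Finite b] (A : Matrix b a ℂ) : IsCP (sandwich A A) :=
  fun _ _ hX => by
    have := Fintype.ofFinite b
    rw [ampliate_sandwich_self]
    exact hX.mul_mul_conjTranspose_same _

lemma isCP_partialTraceRight [Fintype b] : IsCP (partialTraceRight a b) := fun k X hX => by
  have : ampliate (Fin k) (partialTraceRight a b) X =
      ∑ s, X.submatrix (fun p => (p.1, (p.2, s))) (fun p => (p.1, (p.2, s))) := by
    ext p q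
    simp [ampliate, partialTraceRight, Matrix.sum_apply]
  rw [this]
  exact Matrix.posSemidef_sum _ fun _ _ => hX.submatrix _

lemma isCP_appendState [Finite a] [Finite b] {κ : Matrix b b ℂ} (hκ : κ.PosSemidef) :
    IsCP (appendState (a := a) κ) := fun k X hX => by
  have : ampliate (Fin k) (appendState κ) X =
      (X ⊗ₖ κ).submatrix (fun p => ((p.1, p.2.1), p.2.2)) (fun p => ((p.1, p.2.1), p.2.2)) := rfl
  rw [this]
  have := Fintype.ofFinite a
  have := Fintype.ofFinite b
  classical
  exact (hX.kronecker hκ).submatrix _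

/-- Complete positivity may be tested on an arbitrary finite reference system. -/
lemma IsCP.posSemidef_ampliate {r : Type*} [Finite r] {Φ : Matrix a a ℂ →ₗ[ℂ] Matrix b b ℂ}
    (hΦ : IsCP Φ) {X : Matrix (r × a) (r × a) ℂ} (hX : X.PosSemidef) :
    (ampliate r Φ X).PosSemidef := by
  obtain ⟨k, ⟨e⟩⟩ := Finite.exists_equiv_fin r
  have : ampliate r Φ X = (ampliate (Fin k) Φ
      (X.submatrix (fun p => (e.symm p.1, p.2)) (fun p => (e.symm p.1, p.2)))).submatrix
        (fun p => (e p.1, p.2)) (fun p => (e p.1, p.2)) := by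
    ext p q
    simp [ampliate]
  rw [this]
  exact (hΦ k _ (hX.submatrix _)).submatrix _

/-- The map `Φ ⊗ id`, with the additional factor `c` on the right, in contrast to `ampliate`. -/
def tensorId (c : Type*) (Φ : Matrix a a ℂ →ₗ[ℂ] Matrix b b ℂ) :
    Matrix (a × c) (a × c) ℂ →ₗ[ℂ] Matrix (b × c) (b × c) ℂ where
  toFun X := Matrix.of fun p q => Φ (Matrix.of fun i j => X (i, p.2) (j, q.2)) p.1 q.1
  map_add' X Y := by
    ext p q
    exact congrFun (congrFun (map_add Φ (Matrix.of fun i j => X (i, p.2) (j, q.2))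
      (Matrix.of fun i j => Y (i, p.2) (j, q.2))) p.1) q.1
  map_smul' z X := by
    ext p q
    exact congrFun (congrFun (map_smul Φ z (Matrix.of fun i j => X (i, p.2) (j, q.2))) p.1) q.1

lemma IsCP.tensorId [Finite c] {Φ : Matrix a a ℂ →ₗ[ℂ] Matrix b b ℂ} (hΦ : IsCP Φ) :
    IsCP (tensorId c Φ) := fun k X hX => by
  have : ampliate (Fin k) (WML.tensorId c Φ) X =
      (ampliate (Fin k × c) Φ (X.submatrix (fun p => (p.1.1, (p.2, p.1.2)))
        (fun p => (p.1.1, (p.2, p.1.2))))).submatrix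
        (fun p => ((p.1, p.2.2), p.2.1)) (fun p => ((p.1, p.2.2), p.2.1)) := rfl
  rw [this]
  exact (hΦ.posSemidef_ampliate (hX.submatrix _)).submatrix _

/-- The linear map that pulls the indices back along `f`. -/
def pullback (f : b → a) : Matrix a a ℂ →ₗ[ℂ] Matrix b b ℂ where
  toFun X := X.submatrix f f
  map_add' _ _ := rfl
  map_smul' _ _ := rfl

lemma isCP_pullback (f : b → a) : IsCP (pullback f) := fun k X hX => by
  have : ampliate (Fin k) (pullback f) X =
      X.submatrix (fun p => (p.1, f p.2)) (fun p => (p.1, f p.2)) := rfl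
  rw [this]
  exact hX.submatrix _

lemma trace_partialTraceRight [Fintype a] [Fintype b] (X : Matrix (a × b) (a × b) ℂ) :
    (partialTraceRight a b X).trace = X.trace := by
  simp [partialTraceRight, Matrix.trace, Fintype.sum_prod_type]

lemma trace_appendState [Fintype a] [Fintype b] (κ : Matrix b b ℂ) (X : Matrix a a ℂ) :
    (appendState κ X).trace = X.trace * κ.trace := Matrix.trace_kronecker X κ

lemma trace_tensorId [Fintype a] [Fintype b] [Fintype c] {Φ : Matrix a a ℂ →ₗ[ℂ] Matrix b b ℂ}
    (hΦ : ∀ X, (Φ X).trace = X.trace) (X : Matrix (a × c) (a × c) ℂ) :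
    (tensorId c Φ X).trace = X.trace := by
  rw [Matrix.trace, Matrix.trace, Fintype.sum_prod_type_right, Fintype.sum_prod_type_right]
  exact Finset.sum_congr rfl fun s _ => hΦ (Matrix.of fun i j => X (i, s) (j, s))

lemma trace_pullback [Fintype a] [Fintype b] (e : b ≃ a) (X : Matrix a a ℂ) :
    (pullback e X).trace = X.trace :=
  Equiv.sum_comp e fun i => X i i

lemma isCPTP_id [Fintype a] : IsCPTP (LinearMap.id : Matrix a a ℂ →ₗ[ℂ] Matrix a a ℂ) :=
  ⟨isCP_id, fun _ => rfl⟩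

lemma IsCPTP.comp [Fintype a] [Fintype b] [Fintype c] {Φ : Matrix b b ℂ →ₗ[ℂ] Matrix c c ℂ}
    {Ψ : Matrix a a ℂ →ₗ[ℂ] Matrix b b ℂ} (hΦ : IsCPTP Φ) (hΨ : IsCPTP Ψ) : IsCPTP (Φ ∘ₗ Ψ) :=
  ⟨IsCP.comp hΦ.1 hΨ.1, fun X => (hΦ.2 _).trans (hΨ.2 X)⟩

lemma IsCPTP.pow [Fintype a] {Φ : Module.End ℂ (Matrix a a ℂ)} (hΦ : IsCPTP Φ) (n : ℕ) :
    IsCPTP (Φ ^ n) := by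
  induction n with
  | zero => exact isCPTP_id
  | succ n ih =>
    rw [pow_succ]
    exact ih.comp hΦ

end CompletelyPositive

section DiamondBound

variable {a b c : Type*} [Fintype a] [Fintype b] [Fintype c]

/-- A bound on the (unnormalized) diamond norm of a Hermiticity preserving map, in terms of Jordan
decompositions of its values. Restricting the inputs to positive semidefinite matrices loses nothing,
since the diamond norm is a supremum over states. -/
def DiamondBound (D : Matrix a a ℂ →ₗ[ℂ] Matrix b b ℂ) (x : ℝ) : Prop :=
  ∀ (k : ℕ) (ρ : Matrix (Fin k × a) (Fin k × a) ℂ), ρ.PosSemidef →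
    HasJordanBound (ampliate (Fin k) D ρ) (x * ρ.trace.re)

lemma re_trace_nonneg {n : Type*} [Fintype n] {ρ : Matrix n n ℂ} (hρ : ρ.PosSemidef) :
    0 ≤ ρ.trace.re := (Complex.le_def.1 hρ.trace_nonneg).1

lemma DiamondBound.mono {D : Matrix a a ℂ →ₗ[ℂ] Matrix b b ℂ} {x y : ℝ} (h : DiamondBound D x)
    (hxy : x ≤ y) : DiamondBound D y := fun k ρ hρ =>
  (h k ρ hρ).mono (mul_le_mul_of_nonneg_right hxy (re_trace_nonneg hρ))

lemma DiamondBound.add {D E : Matrix a a ℂ →ₗ[ℂ] Matrix b b ℂ} {x y : ℝ} (hD : DiamondBound D x)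
    (hE : DiamondBound E y) : DiamondBound (D + E) (x + y) := fun k ρ hρ => by
  rw [add_mul]
  exact (hD k ρ hρ).add (hE k ρ hρ)

lemma DiamondBound.neg {D : Matrix a a ℂ →ₗ[ℂ] Matrix b b ℂ} {x : ℝ} (hD : DiamondBound D x) :
    DiamondBound (-D) x := fun k ρ hρ => (hD k ρ hρ).neg

lemma DiamondBound.sub {D E : Matrix a a ℂ →ₗ[ℂ] Matrix b b ℂ} {x y : ℝ} (hD : DiamondBound D x)
    (hE : DiamondBound E y) : DiamondBound (D - E) (x + y) := by
  rw [sub_eq_add_neg]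
  exact hD.add hE.neg

lemma DiamondBound.smul {D : Matrix a a ℂ →ₗ[ℂ] Matrix b b ℂ} {x : ℝ} (hD : DiamondBound D x)
    (r : ℝ) : DiamondBound ((r : ℂ) • D) (|r| * x) := fun k ρ hρ => by
  rw [mul_assoc]
  exact (hD k ρ hρ).smul r

lemma DiamondBound.comp {D : Matrix b b ℂ →ₗ[ℂ] Matrix c c ℂ} {E : Matrix a a ℂ →ₗ[ℂ] Matrix b b ℂ}
    {x y : ℝ} (hD : DiamondBound D x) (hx : 0 ≤ x) (hE : DiamondBound E y) :
    DiamondBound (D ∘ₗ E) (x * y) := fun k ρ hρ => by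
  obtain ⟨P, N, hP, hN, hPN, h⟩ := hE k ρ hρ
  rw [ampliate_comp, hPN, ampliate_sub_right, sub_eq_add_neg]
  refine ((hD k P hP).add (hD k N hN).neg).mono ?_
  rw [← mul_add, mul_assoc]
  exact mul_le_mul_of_nonneg_left h hx

lemma diamondBound_of_isCP {Φ : Matrix a a ℂ →ₗ[ℂ] Matrix b b ℂ} (hΦ : IsCP Φ) {x : ℝ}
    (hx : ∀ σ : Matrix a a ℂ, σ.PosSemidef → (Φ σ).trace.re ≤ x * σ.trace.re) :
    DiamondBound Φ x := fun k ρ hρ => by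
  refine ⟨_, 0, hΦ k ρ hρ, Matrix.PosSemidef.zero, (sub_zero _).symm, ?_⟩
  rw [trace_ampliate, ← trace_reducedState ρ]
  simpa using hx _ (posSemidef_reducedState hρ)

lemma IsCPTP.diamondBound {Φ : Matrix a a ℂ →ₗ[ℂ] Matrix b b ℂ} (hΦ : IsCPTP Φ) :
    DiamondBound Φ 1 := diamondBound_of_isCP hΦ.1 fun σ _ => by rw [hΦ.2, one_mul]

/-- The bound `‖A‖_∞² ≤ x` on the operator norm, in the form in which it enters estimates of traces. -/
def SqNormLe (A : Matrix b a ℂ) (x : ℝ) : Prop :=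
  ∀ σ : Matrix a a ℂ, σ.PosSemidef → (A * σ * Aᴴ).trace.re ≤ x * σ.trace.re

lemma SqNormLe.mul {A : Matrix c b ℂ} {B : Matrix b a ℂ} {x y : ℝ} (hA : SqNormLe A x)
    (hx : 0 ≤ x) (hB : SqNormLe B y) : SqNormLe (A * B) (x * y) := fun σ hσ => by
  have h1 := hA _ (hσ.mul_mul_conjTranspose_same B)
  have h2 := mul_le_mul_of_nonneg_left (hB σ hσ) hx
  rw [Matrix.conjTranspose_mul]
  have h3 : A * B * σ * (Bᴴ * Aᴴ) = A * (B * σ * Bᴴ) * Aᴴ := by simp only [Matrix.mul_assoc]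
  rw [h3, mul_assoc]
  exact h1.trans h2

lemma sqNormLe_of_posSemidef [DecidableEq a] {A : Matrix b a ℂ} {x : ℝ}
    (h : ((x : ℂ) • (1 : Matrix a a ℂ) - Aᴴ * A).PosSemidef) : SqNormLe A x := fun σ hσ => by
  have := re_trace_mul_nonneg h hσ
  rw [Matrix.trace_mul_comm, ← Matrix.mul_assoc]
  simp only [sub_mul, Matrix.smul_mul, one_mul, Matrix.trace_sub, Matrix.trace_smul,
    Complex.sub_re, smul_eq_mul, Complex.re_ofReal_mul] at this
  linarith

lemma SqNormLe.diamondBound {A : Matrix b a ℂ} {x : ℝ} (hA : SqNormLe A x) :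
    DiamondBound (sandwich A A) x := diamondBound_of_isCP (isCP_sandwich A) hA

/-- Cross terms, by polarization. -/
lemma diamondBound_cross {A B : Matrix b a ℂ} {x y : ℝ} (hA : SqNormLe A x) (hB : SqNormLe B y) :
    DiamondBound (sandwich A B + sandwich B A) (x + y) := fun k ρ hρ => by
  have h2 : (0 : ℝ) ≤ 1 / 2 := by norm_num
  refine ⟨_, _, ((isCP_sandwich (A + B)).smul h2) k ρ hρ,
    ((isCP_sandwich (A - B)).smul h2) k ρ hρ, ?_, ?_⟩
  · rw [← ampliate_sub_left]
    congr 1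
    ext1 X
    simp only [LinearMap.add_apply, LinearMap.sub_apply, LinearMap.smul_apply, sandwich_apply,
      Matrix.conjTranspose_add, Matrix.conjTranspose_sub, Matrix.add_mul, Matrix.sub_mul,
      Matrix.mul_add, Matrix.mul_sub]
    push_cast
    module
  · rw [trace_ampliate, trace_ampliate, ← trace_reducedState ρ, ← Complex.add_re,
      ← Matrix.trace_add]
    have h : ((((1 / 2 : ℝ) : ℂ) • sandwich (A + B) (A + B)) (reducedState ρ) +
        (((1 / 2 : ℝ) : ℂ) • sandwich (A - B) (A - B)) (reducedState ρ)) =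
        A * reducedState ρ * Aᴴ + B * reducedState ρ * Bᴴ := by
      simp only [LinearMap.smul_apply, sandwich_apply,
        Matrix.conjTranspose_add, Matrix.conjTranspose_sub, Matrix.add_mul, Matrix.sub_mul,
        Matrix.mul_add, Matrix.mul_sub]
      push_cast
      module
    rw [h, Matrix.trace_add, Complex.add_re, add_mul]
    exact add_le_add (hA _ (posSemidef_reducedState hρ)) (hB _ (posSemidef_reducedState hρ))

lemma SqNormLe.smul {A : Matrix b a ℂ} {x : ℝ} (hA : SqNormLe A x) (r : ℝ) :
    SqNormLe ((r : ℂ) • A) (r ^ 2 * x) := fun σ hσ => by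
  have h : ((r : ℂ) • A) * σ * ((r : ℂ) • A)ᴴ = ((r ^ 2 : ℝ) : ℂ) • (A * σ * Aᴴ) := by
    rw [Matrix.conjTranspose_smul, Matrix.smul_mul, Matrix.smul_mul, Matrix.mul_smul, smul_smul]
    congr 1
    simp [sq]
  rw [h, Matrix.trace_smul, smul_eq_mul, Complex.re_ofReal_mul, mul_assoc]
  exact mul_le_mul_of_nonneg_left (hA σ hσ) (sq_nonneg r)

lemma sqNormLe_one [DecidableEq a] : SqNormLe (1 : Matrix a a ℂ) 1 := fun σ _ => by simp

/-- The cross term of `H` and `1`; the two are rescaled to have the same norm. -/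
lemma diamondBound_cross_one [DecidableEq a] {H : Matrix a a ℂ} {x : ℝ} (hx : 0 < x)
    (hH : SqNormLe H (x ^ 2)) : DiamondBound (sandwich H 1 + sandwich 1 H) (2 * x) := by
  have hs : Real.sqrt x ≠ 0 := (Real.sqrt_pos.2 hx).ne'
  have h := diamondBound_cross (hH.smul (Real.sqrt x)⁻¹) (sqNormLe_one.smul (Real.sqrt x))
  have h1 : (Real.sqrt x)⁻¹ ^ 2 * x ^ 2 + Real.sqrt x ^ 2 * 1 = 2 * x := by
    rw [inv_pow, Real.sq_sqrt hx.le]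
    field_simp
    ring
  rw [h1] at h
  convert h using 1
  have hs' : ((Real.sqrt x : ℝ) : ℂ) ≠ 0 := by exact_mod_cast hs
  ext1 X
  simp only [LinearMap.add_apply, sandwich_apply, Matrix.conjTranspose_smul, Matrix.smul_mul,
    Matrix.mul_smul, smul_smul, Complex.star_def, Complex.conj_ofReal, Complex.ofReal_inv, map_inv₀,
    inv_mul_cancel₀ hs', mul_inv_cancel₀ hs', one_smul]

lemma lindblad_eq_sandwich [DecidableEq a] (J : Matrix a a ℂ) :
    lindblad J = sandwich J J -
      ((1 / 2 : ℝ) : ℂ) • (sandwich (Jᴴ * J) 1 + sandwich 1 (Jᴴ * J)) := by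
  ext1 X
  simp [lindblad, sandwich_apply, Matrix.mul_assoc]

lemma diamondBound_lindblad [DecidableEq a] {J : Matrix a a ℂ} {x : ℝ} (hx : 0 < x)
    (hJ : SqNormLe J x) (hJ' : SqNormLe Jᴴ x) : DiamondBound (lindblad J) (2 * x) := by
  rw [lindblad_eq_sandwich]
  have hH : SqNormLe (Jᴴ * J) (x ^ 2) := by
    rw [sq]
    exact hJ'.mul hx.le hJ
  refine (hJ.diamondBound.sub ((diamondBound_cross_one hx hH).smul (1 / 2))).mono ?_
  rw [abs_of_pos (by norm_num)]
  linarith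

lemma DiamondBound.diamondDist_le [DecidableEq b] {Φ Ψ : Matrix a a ℂ →ₗ[ℂ] Matrix b b ℂ} {x : ℝ}
    (h : DiamondBound (Φ - Ψ) (2 * x)) : diamondDist Φ Ψ ≤ ENNReal.ofReal x := by
  have : ENNReal.ofReal x = (1 / 2) * ENNReal.ofReal (2 * x) := by
    rw [ENNReal.ofReal_mul (by norm_num), ← mul_assoc, ENNReal.ofReal_ofNat, one_div,
      ENNReal.inv_mul_cancel (by norm_num) (by norm_num), one_mul]
  rw [diamondDist, this]
  gcongr
  refine iSup_le fun k => iSup_le fun ρ => iSup_le fun hρ => ENNReal.ofReal_le_ofReal ?_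
  have := h k ρ hρ.1
  rw [hρ.2, Complex.one_re, mul_one] at this
  exact this.traceNorm_le

/-- Errors of channels add up under composition. -/
lemma DiamondBound.pow_sub_pow {T E : Module.End ℂ (Matrix a a ℂ)} (hT : IsCPTP T)
    (hE : IsCPTP E) {x : ℝ} (hx : 0 ≤ x) (h : DiamondBound (T - E) x) (n : ℕ) :
    DiamondBound (T ^ n - E ^ n) (n * x) := by
  induction n with
  | zero =>
    intro k ρ hρ
    exact ⟨0, 0, Matrix.PosSemidef.zero, Matrix.PosSemidef.zero, by simp [ampliate]; rfl, by simp⟩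
  | succ n ih =>
    have h1 : T ^ (n + 1) - E ^ (n + 1) = (T ^ n) ∘ₗ (T - E) + (T ^ n - E ^ n) ∘ₗ E := by
      change _ = T ^ n * (T - E) + (T ^ n - E ^ n) * E
      rw [pow_succ, pow_succ, mul_sub, sub_mul]
      abel
    rw [h1]
    refine (((hT.pow n).diamondBound.comp zero_le_one h).add
      (ih.comp (by positivity) hE.diamondBound)).mono ?_
    push_cast
    linarith

end DiamondBound

/-! ### Lindblad semigroups -/

section Semigroup

variable {a : Type*} [Fintype a] [DecidableEq a]

lemma semigroup_zero (𝒢 : Module.End ℂ (Matrix a a ℂ)) : semigroup 𝒢 0 = 1 := by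
  simp [semigroup, NormedSpace.exp_zero]

/-- The identification of the algebra of superoperators with an algebra of matrices through which
`semigroup` is defined. It transports the topology of the matrices to the superoperators. -/
noncomputable abbrev superMatrix :
    Module.End ℂ (Matrix a a ℂ) ≃ₐ[ℂ] Matrix (a × a) (a × a) ℂ :=
  LinearMap.toMatrixAlgEquiv (Matrix.stdBasis ℂ a a)

lemma semigroup_eq (𝒢 : Module.End ℂ (Matrix a a ℂ)) (t : ℝ) :
    semigroup 𝒢 t = superMatrix.symm (NormedSpace.exp ((t : ℂ) • superMatrix 𝒢)) := rfl

lemma semigroup_div_pow (𝒢 : Module.End ℂ (Matrix a a ℂ)) (t : ℝ) {n : ℕ} (hn : n ≠ 0) :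
    semigroup 𝒢 (t / n) ^ n = semigroup 𝒢 t := by
  rw [semigroup_eq, ← map_pow, ← Matrix.exp_nsmul, semigroup_eq, ← Nat.cast_smul_eq_nsmul ℂ,
    smul_smul]
  congr 4
  push_cast
  field_simp

lemma commute_semigroup (𝒢 : Module.End ℂ (Matrix a a ℂ)) (t : ℝ) :
    𝒢 * semigroup 𝒢 t = semigroup 𝒢 t * 𝒢 := by
  apply superMatrix.injective
  rw [map_mul, map_mul, semigroup_eq, AlgEquiv.apply_symm_apply]
  exact ((Commute.refl (superMatrix 𝒢)).smul_right (t : ℂ)).exp_right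

open scoped Matrix.Norms.Operator in
/-- The semigroup solves its differential equation, tested against an arbitrary linear functional, so
that no topology on the superoperators is involved. -/
lemma hasDerivAt_semigroup (𝒢 : Module.End ℂ (Matrix a a ℂ))
    (ψ : Module.End ℂ (Matrix a a ℂ) →ₗ[ℂ] ℂ) (t : ℝ) :
    HasDerivAt (fun s : ℝ => ψ (semigroup 𝒢 s)) (ψ (semigroup 𝒢 t * 𝒢)) t := by
  set φ : Matrix (a × a) (a × a) ℂ →L[ℂ] ℂ :=
    LinearMap.toContinuousLinearMap (ψ ∘ₗ superMatrix.symm.toLinearMap) with hφ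
  have h := φ.hasFDerivAt.comp_hasDerivAt (t : ℂ)
    (hasDerivAt_exp_smul_const (superMatrix 𝒢) (t : ℂ))
  have h2 : HasDerivAt (fun s : ℝ => ψ (semigroup 𝒢 s))
      (φ (NormedSpace.exp ((t : ℂ) • superMatrix 𝒢) * superMatrix 𝒢)) t := h.comp_ofReal
  have h3 : φ (NormedSpace.exp ((t : ℂ) • superMatrix 𝒢) * superMatrix 𝒢) =
      ψ (superMatrix.symm (NormedSpace.exp ((t : ℂ) • superMatrix 𝒢) * superMatrix 𝒢)) := rfl
  rwa [h3, map_mul, AlgEquiv.symm_apply_apply, ← semigroup_eq] at h2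

open scoped Matrix.Norms.Operator in
lemma isCP_of_tendsto {ι : Type*} {l : Filter ι} [l.NeBot]
    {Φ : ι → Module.End ℂ (Matrix a a ℂ)} {Ψ : Module.End ℂ (Matrix a a ℂ)}
    (hΦ : ∀ i, IsCP (Φ i))
    (h : Filter.Tendsto (fun i => superMatrix (Φ i)) l (nhds (superMatrix Ψ))) : IsCP Ψ := by
  intro k X hX
  have key : ∀ φ : Module.End ℂ (Matrix a a ℂ) →ₗ[ℂ] ℂ,
      Filter.Tendsto (fun i => φ (Φ i)) l (nhds (φ Ψ)) := fun φ => by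
    have := ((LinearMap.toContinuousLinearMap
      (φ ∘ₗ superMatrix.symm.toLinearMap)).continuous.tendsto (superMatrix Ψ)).comp h
    simpa [Function.comp_def] using this
  have hent : ∀ p q, Filter.Tendsto (fun i => ampliate (Fin k) (Φ i) X p q) l
      (nhds (ampliate (Fin k) Ψ X p q)) := fun p q => key
    { toFun := fun Φ => ampliate (Fin k) Φ X p q
      map_add' := fun _ _ => rfl
      map_smul' := fun _ _ => rfl }
  have hlim : Filter.Tendsto (fun i => ampliate (Fin k) (Φ i) X) l
      (nhds (ampliate (Fin k) Ψ X)) :=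
    tendsto_pi_nhds.2 fun p => tendsto_pi_nhds.2 fun q => hent p q
  rw [Matrix.posSemidef_iff_dotProduct_mulVec]
  refine ⟨?_, fun x => ?_⟩
  · refine tendsto_nhds_unique (Filter.Tendsto.congr (fun i => ?_) (hlim.star)) hlim
    exact (hΦ i k X hX).1
  · refine ge_of_tendsto' (x := l) (f := fun i => star x ⬝ᵥ (ampliate (Fin k) (Φ i) X) *ᵥ x) ?_
      fun i => (hΦ i k X hX).dotProduct_mulVec_nonneg x
    exact (((continuous_const.dotProduct
      (continuous_id.matrix_mulVec continuous_const))).tendsto _).comp hlim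

open scoped Matrix.Norms.Operator in
lemma IsCP.semigroup {Φ : Module.End ℂ (Matrix a a ℂ)} (hΦ : IsCP Φ) {t : ℝ} (ht : 0 ≤ t) :
    IsCP (semigroup Φ t) := by
  have hs := (NormedSpace.exp_series_hasSum_exp' (𝕂 := ℂ) ((t : ℂ) • superMatrix Φ)).tendsto_sum_nat
  refine isCP_of_tendsto (l := Filter.atTop) (Φ := fun n : ℕ => ∑ i ∈ Finset.range n,
    (((i.factorial : ℝ)⁻¹ * t ^ i : ℝ) : ℂ) • Φ ^ i) (fun n => isCP_sum _ fun i _ => (hΦ.pow i).smul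
      (by positivity)) ?_
  rw [semigroup_eq, AlgEquiv.apply_symm_apply]
  refine hs.congr fun n => ?_
  rw [map_sum]
  refine Finset.sum_congr rfl fun i _ => ?_
  rw [map_smul, map_pow, smul_pow, smul_smul]
  push_cast
  rfl

lemma semigroup_sub_smul_one (Φ : Module.End ℂ (Matrix a a ℂ)) (r t : ℝ) :
    semigroup (Φ - (r : ℂ) • 1) t = ((Real.exp (-(r * t)) : ℝ) : ℂ) • semigroup Φ t := by
  rw [semigroup_eq, semigroup_eq, map_sub, map_smul, map_one, smul_sub, sub_eq_add_neg,
    Matrix.exp_add_of_commute]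
  · have : -((t : ℂ) • (r : ℂ) • (1 : Matrix (a × a) (a × a) ℂ)) =
        Matrix.diagonal fun _ => ((-(r * t) : ℝ) : ℂ) := by
      rw [smul_smul, ← neg_smul, Matrix.smul_one_eq_diagonal]
      congr 1
      ext
      push_cast
      ring
    rw [this, Matrix.exp_diagonal]
    have h2 : NormedSpace.exp (fun _ : a × a => ((-(r * t) : ℝ) : ℂ)) =
        fun _ => ((Real.exp (-(r * t)) : ℝ) : ℂ) := by
      ext i
      rw [Pi.coe_exp, ← Complex.exp_eq_exp_ℂ, Complex.ofReal_exp]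
    rw [h2, ← Matrix.smul_one_eq_diagonal, mul_smul_comm, mul_one, map_smul]
  · exact ((Commute.one_right _).smul_right _).smul_right _ |>.neg_right

open scoped Matrix.Norms.Operator in
/-- Lindblad semigroups are completely positive. With `K = -½ JᴴJ`, the generator is the limit as
`c → ∞` of `X ↦ J X Jᴴ + K X + X K + c⁻¹ K X K`, which differs by the scalar `c` from the completely
positive map `X ↦ J X Jᴴ + c (1 + c⁻¹ K) X (1 + c⁻¹ K)`. -/
lemma isCP_semigroup_lindblad (J : Matrix a a ℂ) {t : ℝ} (ht : 0 ≤ t) :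
    IsCP (semigroup (lindblad J) t) := by
  set K : Matrix a a ℂ := ((-(1 / 2) : ℝ) : ℂ) • (Jᴴ * J) with hK
  have hKH : Kᴴ = K := by
    rw [hK, Matrix.conjTranspose_smul, Matrix.conjTranspose_mul, Matrix.conjTranspose_conjTranspose,
      Complex.star_def, Complex.conj_ofReal]
  have hcp : ∀ c : ℝ, 0 < c →
      IsCP (semigroup (lindblad J + ((c⁻¹ : ℝ) : ℂ) • sandwich K K) t) := fun c hc => by
    have hc' : (c : ℂ) ≠ 0 := by exact_mod_cast hc.ne'
    have : lindblad J + ((c⁻¹ : ℝ) : ℂ) • sandwich K K =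
        (sandwich J J + (c : ℂ) • sandwich (1 + ((c⁻¹ : ℝ) : ℂ) • K) (1 + ((c⁻¹ : ℝ) : ℂ) • K)) -
          (c : ℂ) • 1 := by
      ext1 X
      simp only [lindblad_eq_sandwich, LinearMap.add_apply, LinearMap.sub_apply,
        LinearMap.smul_apply, sandwich_apply, Matrix.conjTranspose_add, Matrix.conjTranspose_smul,
        Matrix.conjTranspose_one, hKH, Complex.star_def, Complex.conj_ofReal, add_mul, mul_add,
        Matrix.smul_mul, Matrix.mul_smul, one_mul, mul_one, smul_add, smul_smul,
        Module.End.one_apply, Complex.ofReal_inv, map_inv₀, mul_inv_cancel₀ hc',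
        mul_inv_cancel_left₀ hc', one_smul]
      have h1 : Jᴴ * J * X = ((-2 : ℝ) : ℂ) • (K * X) := by
        rw [hK, Matrix.smul_mul, smul_smul, ← Complex.ofReal_mul]
        norm_num
      have h2 : X * (Jᴴ * J)ᴴ = ((-2 : ℝ) : ℂ) • (X * K) := by
        rw [hK, Matrix.mul_smul, smul_smul, ← Complex.ofReal_mul, Matrix.conjTranspose_mul,
          Matrix.conjTranspose_conjTranspose]
        norm_num
      rw [h1, h2]
      push_cast
      module
    rw [this, semigroup_sub_smul_one]
    exact (((isCP_sandwich J).add ((isCP_sandwich _).smul hc.le)).semigroup ht).smul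
      (Real.exp_pos _).le
  refine isCP_of_tendsto (l := Filter.atTop)
    (Φ := fun n : ℕ => semigroup (lindblad J + ((((n : ℝ) + 1)⁻¹ : ℝ) : ℂ) • sandwich K K) t)
    (fun n => hcp _ (by positivity)) ?_
  simp only [semigroup_eq, AlgEquiv.apply_symm_apply, map_add, map_smul]
  refine Filter.Tendsto.exp (Filter.Tendsto.const_smul ?_ _)
  have h0 : Filter.Tendsto (fun n : ℕ => ((((n : ℝ) + 1)⁻¹ : ℝ) : ℂ)) Filter.atTop (nhds 0) := by
    have := tendsto_one_div_add_atTop_nhds_zero_nat (𝕜 := ℝ)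
    simp only [one_div] at this
    exact_mod_cast (Complex.continuous_ofReal.tendsto 0).comp this
  have h1 := (h0.smul_const (superMatrix (sandwich K K))).const_add (superMatrix (lindblad J))
  rwa [zero_smul, add_zero] at h1

lemma trace_lindblad (J X : Matrix a a ℂ) : (lindblad J X).trace = 0 := by
  have h1 : (J * X * Jᴴ).trace = (Jᴴ * J * X).trace := by
    rw [Matrix.trace_mul_comm, ← Matrix.mul_assoc]
  have h2 : (X * (Jᴴ * J)).trace = (Jᴴ * J * X).trace := Matrix.trace_mul_comm _ _
  simp only [lindblad, LinearMap.coe_mk, AddHom.coe_mk, Matrix.trace_sub, Matrix.trace_smul,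
    Matrix.trace_add, h1, h2, smul_eq_mul]
  ring

lemma trace_semigroup_lindblad (J : Matrix a a ℂ) (t : ℝ) (X : Matrix a a ℂ) :
    (semigroup (lindblad J) t X).trace = X.trace := by
  set ψ : Module.End ℂ (Matrix a a ℂ) →ₗ[ℂ] ℂ := Matrix.traceLinearMap a ℂ ℂ ∘ₗ
    LinearMap.applyₗ X with hψ
  have h0 : ∀ s, HasDerivAt (fun s : ℝ => ψ (semigroup (lindblad J) s)) 0 s := fun s => by
    convert hasDerivAt_semigroup (lindblad J) ψ s using 1
    rw [← commute_semigroup]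
    exact (trace_lindblad J _).symm
  have := is_const_of_deriv_eq_zero (fun s => (h0 s).differentiableAt) (fun s => (h0 s).deriv) t 0
  rw [semigroup_zero] at this
  exact this

lemma isCPTP_semigroup_lindblad (J : Matrix a a ℂ) {t : ℝ} (ht : 0 ≤ t) :
    IsCPTP (semigroup (lindblad J) t) :=
  ⟨isCP_semigroup_lindblad J ht, trace_semigroup_lindblad J t⟩

/-- An eigenvector of the generator is an eigenvector of the semigroup. -/
lemma semigroup_apply_of_eigenvector {𝒢 : Module.End ℂ (Matrix a a ℂ)} {X : Matrix a a ℂ} {r : ℝ}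
    (h : 𝒢 X = (r : ℂ) • X) (t : ℝ) :
    semigroup 𝒢 t X = ((Real.exp (r * t) : ℝ) : ℂ) • X := by
  have h0 : ∀ (i j : a) (s : ℝ), HasDerivAt
      (fun s : ℝ => ((Real.exp (-(r * s)) : ℝ) : ℂ) * semigroup 𝒢 s X i j) 0 s := fun i j s => by
    have h1 := hasDerivAt_semigroup 𝒢
      (Matrix.entryLinearMap ℂ ℂ i j ∘ₗ LinearMap.applyₗ X) s
    have h2 : HasDerivAt (fun s : ℝ => ((Real.exp (-(r * s)) : ℝ) : ℂ))
        ((Real.exp (-(r * s)) * -r : ℝ) : ℂ) s := by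
      refine HasDerivAt.ofReal_comp ?_
      have := (((hasDerivAt_id s).const_mul r).neg).exp
      simpa using this
    have h3 : (Matrix.entryLinearMap ℂ ℂ i j ∘ₗ LinearMap.applyₗ X) (semigroup 𝒢 s * 𝒢) =
        (r : ℂ) * semigroup 𝒢 s X i j := by
      change semigroup 𝒢 s (𝒢 X) i j = _
      rw [h, map_smul, Matrix.smul_apply, smul_eq_mul]
    rw [h3] at h1
    refine (h2.mul h1).congr_deriv ?_
    change _ * semigroup 𝒢 s X i j + _ = _
    push_cast
    ring
  ext i j
  have := is_const_of_deriv_eq_zero (fun s => (h0 i j s).differentiableAt)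
    (fun s => (h0 i j s).deriv) t 0
  rw [semigroup_zero] at this
  simp only [mul_zero, neg_zero, Real.exp_zero, Complex.ofReal_one, one_mul,
    Module.End.one_apply] at this
  rw [Matrix.smul_apply, ← this, smul_eq_mul, ← mul_assoc, ← Complex.ofReal_mul, ← Real.exp_add]
  simp

end Semigroup

/-! ### A single step of wave matrix Lindbladization -/

section Norms

variable {n : Type*} [Fintype n]

lemma frobNorm_sq (A : Matrix n n ℂ) : frobNorm A ^ 2 = ∑ i, ∑ j, ‖A i j‖ ^ 2 :=
  Real.sq_sqrt (by positivity)

lemma frobNorm_nonneg (A : Matrix n n ℂ) : 0 ≤ frobNorm A := Real.sqrt_nonneg _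

variable [DecidableEq n]

lemma opNorm_nonneg (A : Matrix n n ℂ) : 0 ≤ opNorm A := norm_nonneg _

lemma opNorm_conjTranspose (A : Matrix n n ℂ) : opNorm Aᴴ = opNorm A := by
  rw [opNorm, opNorm, ← Matrix.star_eq_conjTranspose, map_star,
    ContinuousLinearMap.star_eq_adjoint, LinearIsometryEquiv.norm_map]

lemma opNorm_le_frobNorm (A : Matrix n n ℂ) : opNorm A ≤ frobNorm A := by
  refine ContinuousLinearMap.opNorm_le_bound _ (frobNorm_nonneg A) fun x => ?_
  refine (pow_le_pow_iff_left₀ (norm_nonneg _)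
    (mul_nonneg (frobNorm_nonneg A) (norm_nonneg x)) two_ne_zero).1 ?_
  rw [mul_pow, frobNorm_sq, EuclideanSpace.norm_sq_eq, EuclideanSpace.norm_sq_eq, Finset.sum_mul]
  refine Finset.sum_le_sum fun i _ => ?_
  have h1 : ‖(Matrix.toEuclideanCLM (n := n) (𝕜 := ℂ) A x) i‖ ≤ ∑ j, ‖A i j‖ * ‖x j‖ := by
    change ‖(A *ᵥ x.ofLp) i‖ ≤ _
    refine (norm_sum_le _ _).trans (le_of_eq ?_)
    exact Finset.sum_congr rfl fun j _ => norm_mul _ _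
  exact (pow_le_pow_left₀ (norm_nonneg _) h1 2).trans (Finset.sum_mul_sq_le_sq_mul_sq _ _ _)

lemma opNorm_pos {A : Matrix n n ℂ} (hA : A ≠ 0) : 0 < opNorm A :=
  norm_pos_iff.2 fun h =>
    hA ((map_eq_zero_iff _ (Matrix.toEuclideanCLM (n := n) (𝕜 := ℂ)).injective).1 h)

lemma sqNormLe_opNorm (A : Matrix n n ℂ) : SqNormLe A (opNorm A ^ 2) := by
  refine sqNormLe_of_posSemidef (Matrix.PosSemidef.of_dotProduct_mulVec_nonneg ?_ fun x => ?_)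
  · exact Matrix.IsHermitian.sub (by
      rw [Matrix.IsHermitian, Matrix.conjTranspose_smul, Matrix.conjTranspose_one, Complex.star_def,
        Complex.conj_ofReal]) (Matrix.isHermitian_conjTranspose_mul_self A)
  · have hd : ∀ y : n → ℂ, star y ⬝ᵥ y = ((‖WithLp.toLp 2 y‖ ^ 2 : ℝ) : ℂ) := fun y => by
      rw [EuclideanSpace.norm_sq_eq, dotProduct]
      push_cast
      exact Finset.sum_congr rfl fun i _ => Complex.conj_mul' _
    have h1 : star x ⬝ᵥ (Aᴴ * A) *ᵥ x = star (A *ᵥ x) ⬝ᵥ (A *ᵥ x) := by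
      rw [← Matrix.mulVec_mulVec, Matrix.star_mulVec, Matrix.dotProduct_mulVec]
    have h2 : ‖WithLp.toLp 2 (A *ᵥ x)‖ ≤ opNorm A * ‖WithLp.toLp 2 x‖ :=
      (Matrix.toEuclideanCLM (n := n) (𝕜 := ℂ) A).le_opNorm (WithLp.toLp 2 x)
    rw [Matrix.sub_mulVec, dotProduct_sub, Matrix.smul_mulVec, Matrix.one_mulVec, dotProduct_smul,
      h1, hd, hd, smul_eq_mul, ← Complex.ofReal_mul, sub_nonneg]
    have h3 := pow_le_pow_left₀ (norm_nonneg _) h2 2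
    rw [mul_pow] at h3
    exact_mod_cast h3

end Norms

section Taylor

/-- Second-order Taylor bound from above. -/
lemma le_of_second_deriv_le {g g' g'' : ℝ → ℝ} {x : ℝ} (hg : ∀ s, HasDerivAt g (g' s) s)
    (hg' : ∀ s, HasDerivAt g' (g'' s) s) (h0 : g 0 = 0) (h0' : g' 0 = 0)
    (hx : ∀ s, 0 ≤ s → g'' s ≤ x) {t : ℝ} (ht : 0 ≤ t) : g t ≤ x * t ^ 2 / 2 := by
  have h1 : ∀ s, HasDerivAt (fun s => x * s - g' s) (x - g'' s) s := fun s => by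
    refine HasDerivAt.sub ?_ (hg' s)
    simpa using (hasDerivAt_id s).const_mul x
  have m1 : MonotoneOn (fun s => x * s - g' s) (Set.Ici 0) := by
    refine monotoneOn_of_deriv_nonneg (convex_Ici 0)
      (fun s _ => (h1 s).continuousAt.continuousWithinAt)
      (fun s _ => (h1 s).differentiableAt.differentiableWithinAt) fun s hs => ?_
    rw [(h1 s).deriv]
    rw [interior_Ici] at hs
    linarith [hx s (le_of_lt hs)]
  have h2 : ∀ s, HasDerivAt (fun s => x * s ^ 2 / 2 - g s) (x * s - g' s) s := fun s => by
    refine HasDerivAt.sub ?_ (hg s)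
    have := (((hasDerivAt_id s).pow 2).const_mul x).div_const 2
    refine this.congr_deriv ?_
    simp
    ring
  have m2 : MonotoneOn (fun s => x * s ^ 2 / 2 - g s) (Set.Ici 0) := by
    refine monotoneOn_of_deriv_nonneg (convex_Ici 0)
      (fun s _ => (h2 s).continuousAt.continuousWithinAt)
      (fun s _ => (h2 s).differentiableAt.differentiableWithinAt) fun s hs => ?_
    rw [(h2 s).deriv]
    rw [interior_Ici] at hs
    have := m1 Set.self_mem_Ici (Set.mem_Ici.2 (le_of_lt hs)) (le_of_lt hs)
    simpa [h0'] using this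
  have := m2 Set.self_mem_Ici (Set.mem_Ici.2 ht) ht
  simpa [h0] using this

end Taylor

section Step

variable {d : ℕ}

/-- The map `V : ψ ↦ ψ ⊗ |L⟩` that appends the program. -/
def appendKet (L : Matrix (Fin d) (Fin d) ℂ) : Matrix (Fin d × Fin d × Fin d) (Fin d) ℂ :=
  Matrix.of fun p m => if p.1 = m then L p.2.1 p.2.2 else 0

lemma ket_apply (L : Matrix (Fin d) (Fin d) ℂ) (p : Fin d × Fin d) : ket L p = L p.1 p.2 := by
  simp [ket, Matrix.mulVec, dotProduct, Fintype.sum_prod_type, gammaVec, Matrix.kroneckerMap_apply,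
    Matrix.one_apply]

lemma appendState_programState (L : Matrix (Fin d) (Fin d) ℂ) :
    appendState (programState L) = sandwich (appendKet L) (appendKet L) := by
  ext1 X
  ext p q
  simp [appendState, sandwich_apply, programState, Matrix.vecMulVec_apply, ket_apply,
    Matrix.kroneckerMap_apply, Matrix.mul_apply, appendKet, apply_ite (starRingEnd ℂ)]
  ring

lemma trace_programState (L : Matrix (Fin d) (Fin d) ℂ) (hL : frobNorm L = 1) :
    (programState L).trace = 1 := by
  have h : (programState L).trace = ((frobNorm L ^ 2 : ℝ) : ℂ) := by
    rw [frobNorm_sq, Matrix.trace, Fintype.sum_prod_type]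
    push_cast
    refine Finset.sum_congr rfl fun i _ => Finset.sum_congr rfl fun j _ => ?_
    simp [programState, Matrix.vecMulVec_apply, ket_apply, Complex.mul_conj']
  rw [h, hL]
  simp

lemma posSemidef_programState (L : Matrix (Fin d) (Fin d) ℂ) : (programState L).PosSemidef :=
  Matrix.posSemidef_vecMulVec_self_star _

lemma wmlJump_apply (p q : Fin d × Fin d × Fin d) : wmlJump d p q =
    if p.1 = q.2.1 ∧ p.2.1 = p.2.2 ∧ q.1 = q.2.2 then ((1 / Real.sqrt d : ℝ) : ℂ) else 0 := by
  obtain ⟨i, j, k⟩ := p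
  obtain ⟨i', j', k'⟩ := q
  have h : ∀ x : Fin d × Fin d × Fin d, swap12 d x (i', j', k') =
      if x = (j', i', k') then 1 else 0 := fun x => by
    simp only [swap12, Matrix.of_apply, Prod.ext_iff]
  simp only [wmlJump, Matrix.smul_apply, Matrix.mul_apply, h, mul_ite, mul_one, mul_zero,
    Finset.sum_ite_eq', Finset.mem_univ, if_true, Matrix.kroneckerMap_apply, Matrix.one_apply,
    Matrix.vecMulVec_apply, gammaVec, Pi.star_apply]
  by_cases h1 : i = j' <;> by_cases h2 : j = k <;> by_cases h3 : i' = k' <;>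
    simp [h1, h2, h3]

lemma wmlJump_mul_appendKet (L : Matrix (Fin d) (Fin d) ℂ) : wmlJump d * appendKet L =
    Matrix.of fun p m => if p.2.1 = p.2.2 then ((1 / Real.sqrt d : ℝ) : ℂ) * L p.1 m else 0 := by
  ext ⟨i, j, k⟩ m
  simp [Matrix.mul_apply, wmlJump_apply, appendKet, Fintype.sum_prod_type, ite_and]

lemma ofReal_one_div_sqrt_mul_self (hd : 0 < d) :
    ((1 / Real.sqrt d : ℝ) : ℂ) * ((1 / Real.sqrt d : ℝ) : ℂ) * d = 1 := by
  have h : (1 / Real.sqrt d) * (1 / Real.sqrt d) * d = 1 := by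
    have : (0 : ℝ) < d := by exact_mod_cast hd
    rw [← sq, div_pow, Real.sq_sqrt this.le]
    field_simp
  exact_mod_cast h

/-- The Gram matrix `JᴴJ` is `|Γ⟩⟨Γ|` on the outer factors, tensored with the identity. -/
lemma gram_wmlJump_apply (hd : 0 < d) (p q : Fin d × Fin d × Fin d) :
    ((wmlJump d)ᴴ * wmlJump d) p q =
      if p.2.1 = q.2.1 ∧ p.1 = p.2.2 ∧ q.1 = q.2.2 then 1 else 0 := by
  obtain ⟨i, j, k⟩ := p
  obtain ⟨i', j', k'⟩ := q
  have h := ofReal_one_div_sqrt_mul_self hd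
  by_cases h1 : j = j' <;> by_cases h2 : i = k <;> by_cases h3 : i' = k' <;>
    simp [Matrix.mul_apply, Matrix.conjTranspose_apply, wmlJump_apply, Fintype.sum_prod_type,
      ite_and, h1, h2, h3, apply_ite (starRingEnd ℂ)]
  · rw [← h]
    push_cast
    rw [one_div]
    ring
  · exact fun h' => absurd h'.symm h1

lemma gram_wmlJump_mul_appendKet (hd : 0 < d) (L : Matrix (Fin d) (Fin d) ℂ) :
    (wmlJump d)ᴴ * wmlJump d * appendKet L =
      Matrix.of fun p m => if p.1 = p.2.2 then L p.2.1 m else 0 := by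
  ext ⟨i, j, k⟩ m
  rw [Matrix.mul_apply]
  simp [gram_wmlJump_apply hd, appendKet, Fintype.sum_prod_type, ite_and]

lemma gram_wmlJump_sq (hd : 0 < d) : (wmlJump d)ᴴ * wmlJump d * ((wmlJump d)ᴴ * wmlJump d) =
    (d : ℂ) • ((wmlJump d)ᴴ * wmlJump d) := by
  ext ⟨i, j, k⟩ ⟨i', j', k'⟩
  rw [Matrix.mul_apply]
  by_cases h1 : j = j' <;> by_cases h2 : i = k <;> by_cases h3 : i' = k' <;>
    simp [gram_wmlJump_apply hd, Fintype.sum_prod_type, ite_and, h1, h2, h3]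

lemma wmlJump_mul_gram (hd : 0 < d) :
    wmlJump d * ((wmlJump d)ᴴ * wmlJump d) = (d : ℂ) • wmlJump d := by
  have h := gram_wmlJump_sq hd
  rw [← sub_eq_zero, ← Matrix.conjTranspose_mul_self_eq_zero]
  set J := wmlJump d
  have hs : ((d : ℂ) • J)ᴴ = (d : ℂ) • Jᴴ := by simp [Matrix.conjTranspose_smul]
  have h1 : (J * (Jᴴ * J) - (d : ℂ) • J)ᴴ * (J * (Jᴴ * J) - (d : ℂ) • J) =
      (Jᴴ * J * (Jᴴ * J)) * (Jᴴ * J) - (d : ℂ) • (Jᴴ * J * (Jᴴ * J)) -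
      (d : ℂ) • (Jᴴ * J * (Jᴴ * J) - (d : ℂ) • (Jᴴ * J)) := by
    rw [Matrix.conjTranspose_sub, hs]
    simp only [Matrix.conjTranspose_mul, Matrix.conjTranspose_conjTranspose, sub_mul, mul_sub,
      Matrix.smul_mul, Matrix.mul_smul, smul_sub, Matrix.mul_assoc]
  rw [h1, h, Matrix.smul_mul, h, sub_self, sub_self, smul_zero, sub_zero]

/-- The hypothesis says that `AᴴA` is `x` times a projection. -/
lemma sqNormLe_of_gram_sq {m n : Type*} [Fintype m] [Fintype n] [DecidableEq n] {A : Matrix m n ℂ}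
    {x : ℝ} (hx : 0 < x) (h : Aᴴ * A * (Aᴴ * A) = (x : ℂ) • (Aᴴ * A)) : SqNormLe A x := by
  refine sqNormLe_of_posSemidef ?_
  set B := (x : ℂ) • (1 : Matrix n n ℂ) - Aᴴ * A with hB
  have hBH : Bᴴ = B := by
    rw [hB, Matrix.conjTranspose_sub, Matrix.conjTranspose_smul, Matrix.conjTranspose_one,
      Complex.star_def, Complex.conj_ofReal, Matrix.conjTranspose_mul,
      Matrix.conjTranspose_conjTranspose]
  have h1 : B = ((x⁻¹ : ℝ) : ℂ) • (Bᴴ * B) := by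
    have h2 : Bᴴ * B = (x : ℂ) • B := by
      rw [hBH]
      nth_rewrite 1 [hB]
      rw [sub_mul, Matrix.smul_mul, one_mul]
      have : Aᴴ * A * B = 0 := by
        rw [hB, mul_sub, h, Matrix.mul_smul, mul_one, sub_self]
      rw [this, sub_zero]
    rw [h2, smul_smul, ← Complex.ofReal_mul, inv_mul_cancel₀ hx.ne']
    simp
  rw [h1]
  exact (Matrix.posSemidef_conjTranspose_mul_self B).smul
    (by exact_mod_cast (inv_pos.2 hx).le : (0 : ℂ) ≤ ((x⁻¹ : ℝ) : ℂ))

lemma sqNormLe_wmlJump (hd : 0 < d) : SqNormLe (wmlJump d) d :=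
  sqNormLe_of_gram_sq (by exact_mod_cast hd) (by exact_mod_cast gram_wmlJump_sq hd)

lemma sqNormLe_wmlJump_conjTranspose (hd : 0 < d) : SqNormLe (wmlJump d)ᴴ d := by
  refine sqNormLe_of_gram_sq (by exact_mod_cast hd) ?_
  have h := wmlJump_mul_gram hd
  rw [Matrix.conjTranspose_conjTranspose, ← mul_assoc, mul_assoc (wmlJump d), h, Matrix.smul_mul]
  simp

/-- `SqNormLe` depends on the Gram matrix only. -/
lemma SqNormLe.of_gram_eq {m m' n : Type*} [Fintype m] [Fintype m'] [Fintype n]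
    {A : Matrix m n ℂ} {B : Matrix m' n ℂ} {x r : ℝ} (hB : SqNormLe B x) (hr : 0 ≤ r)
    (h : Aᴴ * A = (r : ℂ) • (Bᴴ * B)) : SqNormLe A (r * x) := fun σ hσ => by
  have h1 := mul_le_mul_of_nonneg_left (hB σ hσ) hr
  rw [Matrix.trace_mul_comm, ← Matrix.mul_assoc] at h1
  rw [Matrix.trace_mul_comm, ← Matrix.mul_assoc, h, Matrix.smul_mul, Matrix.trace_smul, smul_eq_mul,
    Complex.re_ofReal_mul, mul_assoc]
  exact h1

lemma gram_wmlJump_mul_appendKet_eq (hd : 0 < d) (L : Matrix (Fin d) (Fin d) ℂ) :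
    (wmlJump d * appendKet L)ᴴ * (wmlJump d * appendKet L) = Lᴴ * L := by
  have h := ofReal_one_div_sqrt_mul_self hd
  rw [wmlJump_mul_appendKet]
  ext i j
  simp only [Matrix.mul_apply, Fintype.sum_prod_type, Matrix.conjTranspose_apply, Matrix.of_apply]
  refine Finset.sum_congr rfl fun x _ => ?_
  simp only [apply_ite star, star_zero, ite_mul, mul_ite, zero_mul, mul_zero, Finset.sum_ite_eq,
    Finset.mem_univ, if_true, Finset.sum_const, Finset.card_univ, Fintype.card_fin, nsmul_eq_mul,
    StarMul.star_mul, Complex.star_def, Complex.conj_ofReal]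
  linear_combination (starRingEnd ℂ (L x i) * L x j) * h

lemma sqNormLe_wmlJump_mul_appendKet (hd : 0 < d) (L : Matrix (Fin d) (Fin d) ℂ) :
    SqNormLe (wmlJump d * appendKet L) (opNorm L ^ 2) := by
  have := (sqNormLe_opNorm L).of_gram_eq (A := wmlJump d * appendKet L) zero_le_one
    (by rw [gram_wmlJump_mul_appendKet_eq hd]; simp)
  rwa [one_mul] at this

lemma sqNormLe_gram_mul_appendKet (hd : 0 < d) (L : Matrix (Fin d) (Fin d) ℂ) :
    SqNormLe ((wmlJump d)ᴴ * wmlJump d * appendKet L) (d * opNorm L ^ 2) := by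
  refine (sqNormLe_opNorm L).of_gram_eq (by positivity) ?_
  rw [← gram_wmlJump_mul_appendKet_eq hd]
  have h := gram_wmlJump_sq hd
  set J := wmlJump d
  set V := appendKet L
  calc _ = Vᴴ * (Jᴴ * J * (Jᴴ * J)) * V := by
        simp only [Matrix.conjTranspose_mul, Matrix.conjTranspose_conjTranspose, Matrix.mul_assoc]
    _ = _ := by
        rw [h]
        simp only [Matrix.conjTranspose_mul, Matrix.mul_smul, Matrix.smul_mul, Matrix.mul_assoc]
        push_cast
        rfl

lemma partialTraceRight_apply {a b : Type*} [Fintype b] (X : Matrix (a × b) (a × b) ℂ) (i j : a) :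
    partialTraceRight a b X i j = ∑ s, X (i, s) (j, s) := rfl

lemma partialTraceRight_sandwich_wmlJump (hd : 0 < d) (L : Matrix (Fin d) (Fin d) ℂ) :
    partialTraceRight (Fin d) (Fin d × Fin d) ∘ₗ
      sandwich (wmlJump d * appendKet L) (wmlJump d * appendKet L) = sandwich L L := by
  have h := ofReal_one_div_sqrt_mul_self hd
  set c : ℂ := ((1 / Real.sqrt d : ℝ) : ℂ) with hc
  have hcs : star c = c := Complex.conj_ofReal _
  ext1 X
  ext i j
  have key : ∀ s : Fin d × Fin d, ((wmlJump d * appendKet L) * X * (wmlJump d * appendKet L)ᴴ)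
      (i, s) (j, s) = if s.1 = s.2 then c * c * (L * X * Lᴴ) i j else 0 := fun s => by
    rw [wmlJump_mul_appendKet]
    split_ifs with hs
    · simp only [Matrix.mul_apply, Matrix.conjTranspose_apply, Matrix.of_apply, hs, if_true,
        Finset.mul_sum, Finset.sum_mul, StarMul.star_mul, ← hc, hcs]
      exact Finset.sum_congr rfl fun _ _ => Finset.sum_congr rfl fun _ _ => by ring
    · simp [Matrix.mul_apply, hs]
  rw [LinearMap.comp_apply, partialTraceRight_apply]
  simp only [sandwich_apply, key, Fintype.sum_prod_type, Finset.sum_ite_eq, Finset.mem_univ,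
    if_true, Finset.sum_const, Finset.card_univ, Fintype.card_fin, nsmul_eq_mul]
  linear_combination (L * X * Lᴴ) i j * h

lemma partialTraceRight_sandwich_gram (hd : 0 < d) (L : Matrix (Fin d) (Fin d) ℂ) :
    partialTraceRight (Fin d) (Fin d × Fin d) ∘ₗ
      sandwich ((wmlJump d)ᴴ * wmlJump d * appendKet L) (appendKet L) = sandwich (Lᴴ * L) 1 := by
  ext1 X
  ext i j
  have key : ∀ s : Fin d × Fin d,
      (((wmlJump d)ᴴ * wmlJump d * appendKet L) * X * (appendKet L)ᴴ) (i, s) (j, s) =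
        if i = s.2 then (∑ m, L s.1 m * X m j) * star (L s.1 s.2) else 0 := fun s => by
    rw [gram_wmlJump_mul_appendKet hd]
    simp [Matrix.mul_apply, appendKet, apply_ite (starRingEnd ℂ), Finset.sum_ite_irrel]
  rw [LinearMap.comp_apply, partialTraceRight_apply]
  simp only [sandwich_apply, key, Fintype.sum_prod_type, Finset.sum_ite_eq, Finset.mem_univ,
    if_true, Matrix.conjTranspose_one, mul_one]
  rw [Matrix.mul_assoc, Matrix.mul_apply]
  exact Finset.sum_congr rfl fun _ _ => mul_comm _ _

lemma partialTraceRight_sandwich_gram' (hd : 0 < d) (L : Matrix (Fin d) (Fin d) ℂ) :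
    partialTraceRight (Fin d) (Fin d × Fin d) ∘ₗ
      sandwich (appendKet L) ((wmlJump d)ᴴ * wmlJump d * appendKet L) = sandwich 1 (Lᴴ * L) := by
  ext1 X
  have h := congrArg Matrix.conjTranspose
    (LinearMap.congr_fun (partialTraceRight_sandwich_gram hd L) Xᴴ)
  simp only [LinearMap.comp_apply, sandwich_apply] at h ⊢
  have h1 : ∀ Y : Matrix (Fin d × Fin d × Fin d) (Fin d × Fin d × Fin d) ℂ,
      (partialTraceRight (Fin d) (Fin d × Fin d) Y)ᴴ =
        partialTraceRight (Fin d) (Fin d × Fin d) Yᴴ := fun Y => by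
    ext i j
    simp [partialTraceRight_apply, Matrix.conjTranspose_apply]
  rw [h1] at h
  simpa [Matrix.conjTranspose_mul, Matrix.mul_assoc] using h

lemma wmlStep_eq (L : Matrix (Fin d) (Fin d) ℂ) (t : ℝ) : wmlStep L t =
    partialTraceRight (Fin d) (Fin d × Fin d) ∘ₗ semigroup (lindblad (wmlJump d)) t ∘ₗ
      appendState (programState L) := rfl

lemma partialTraceRight_appendState (L : Matrix (Fin d) (Fin d) ℂ) (hL : frobNorm L = 1) :
    partialTraceRight (Fin d) (Fin d × Fin d) ∘ₗ appendState (programState L) =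
      LinearMap.id := by
  ext1 X
  ext i j
  have : (partialTraceRight (Fin d) (Fin d × Fin d) ∘ₗ appendState (programState L)) X i j =
      X i j * (programState L).trace := by
    rw [Matrix.trace, Finset.mul_sum]
    rfl
  rw [this, trace_programState L hL, mul_one]
  rfl

/-- The off-diagonal part `G X Π + Π X G` of `X = V ρ Vᴴ`, where `G = JᴴJ` is `d` times a projection
and `Π = 1 - G / d`. On it, the generator with the jump operator `J` acts as the scalar `-d / 2`. -/
noncomputable def offDiagonal (d : ℕ) (L : Matrix (Fin d) (Fin d) ℂ) :
    Matrix (Fin d) (Fin d) ℂ →ₗ[ℂ]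
      Matrix (Fin d × Fin d × Fin d) (Fin d × Fin d × Fin d) ℂ :=
  sandwich ((wmlJump d)ᴴ * wmlJump d * appendKet L) (appendKet L) +
    sandwich (appendKet L) ((wmlJump d)ᴴ * wmlJump d * appendKet L) -
    ((2 / d : ℝ) : ℂ) • sandwich ((wmlJump d)ᴴ * wmlJump d * appendKet L)
      ((wmlJump d)ᴴ * wmlJump d * appendKet L)

lemma lindblad_sandwich {a b : Type*} [Fintype a] [Fintype b] [DecidableEq a] (J : Matrix a a ℂ)
    (A B : Matrix a b ℂ) (X : Matrix b b ℂ) :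
    lindblad J (sandwich A B X) = sandwich (J * A) (J * B) X -
      ((1 / 2 : ℝ) : ℂ) • (sandwich (Jᴴ * J * A) B X + sandwich A (Jᴴ * J * B) X) := by
  simp only [lindblad, LinearMap.coe_mk, AddHom.coe_mk, sandwich_apply, Matrix.conjTranspose_mul,
    Matrix.conjTranspose_conjTranspose, Matrix.mul_assoc]
  push_cast
  rfl

lemma smul_sandwich {a b : Type*} [Fintype a] (r : ℝ) (A B : Matrix b a ℂ) :
    sandwich ((r : ℂ) • A) B = (r : ℂ) • sandwich A B := by
  ext1 X
  simp only [sandwich_apply, LinearMap.smul_apply, Matrix.smul_mul]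

lemma sandwich_smul {a b : Type*} [Fintype a] (r : ℝ) (A B : Matrix b a ℂ) :
    sandwich A ((r : ℂ) • B) = (r : ℂ) • sandwich A B := by
  ext1 X
  simp only [sandwich_apply, LinearMap.smul_apply, Matrix.mul_smul, Matrix.conjTranspose_smul,
    Complex.star_def, Complex.conj_ofReal]

lemma lindblad_offDiagonal (hd : 0 < d) (L : Matrix (Fin d) (Fin d) ℂ)
    (X : Matrix (Fin d) (Fin d) ℂ) :
    lindblad (wmlJump d) (offDiagonal d L X) = ((-(d / 2) : ℝ) : ℂ) • offDiagonal d L X := by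
  have hd' : (d : ℂ) ≠ 0 := by exact_mod_cast hd.ne'
  have e1 : wmlJump d * ((wmlJump d)ᴴ * wmlJump d * appendKet L) =
      ((d : ℝ) : ℂ) • (wmlJump d * appendKet L) := by
    rw [← Matrix.mul_assoc, wmlJump_mul_gram hd, Matrix.smul_mul, Complex.ofReal_natCast]
  have e2 : (wmlJump d)ᴴ * wmlJump d * ((wmlJump d)ᴴ * wmlJump d * appendKet L) =
      ((d : ℝ) : ℂ) • ((wmlJump d)ᴴ * wmlJump d * appendKet L) := by
    rw [← Matrix.mul_assoc, gram_wmlJump_sq hd, Matrix.smul_mul, Complex.ofReal_natCast]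
  simp only [offDiagonal, LinearMap.add_apply, LinearMap.sub_apply, LinearMap.smul_apply, map_add,
    map_sub, map_smul, lindblad_sandwich, e1, e2, smul_sandwich, sandwich_smul]
  push_cast
  match_scalars <;> field_simp <;> ring

lemma lindblad_appendState (L : Matrix (Fin d) (Fin d) ℂ) (hd : 0 < d) :
    lindblad (wmlJump d) ∘ₗ appendState (programState L) =
      sandwich (wmlJump d * appendKet L) (wmlJump d * appendKet L) -
      ((1 / d : ℝ) : ℂ) • sandwich ((wmlJump d)ᴴ * wmlJump d * appendKet L)
        ((wmlJump d)ᴴ * wmlJump d * appendKet L) -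
      ((1 / 2 : ℝ) : ℂ) • offDiagonal d L := by
  have hd' : (d : ℂ) ≠ 0 := by exact_mod_cast hd.ne'
  ext1 X
  rw [appendState_programState, LinearMap.comp_apply, lindblad_sandwich]
  simp only [offDiagonal, LinearMap.add_apply, LinearMap.sub_apply, LinearMap.smul_apply]
  push_cast
  match_scalars <;> field_simp
  ring

/-- To first order, a step of the algorithm is exact. -/
lemma partialTraceRight_lindblad_appendState (hd : 0 < d) (L : Matrix (Fin d) (Fin d) ℂ) :
    partialTraceRight (Fin d) (Fin d × Fin d) ∘ₗ lindblad (wmlJump d) ∘ₗ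
      appendState (programState L) = lindblad L := by
  ext1 X
  rw [appendState_programState, LinearMap.comp_apply, LinearMap.comp_apply, lindblad_sandwich,
    map_sub, map_smul, map_add]
  have h1 := LinearMap.congr_fun (partialTraceRight_sandwich_wmlJump hd L) X
  have h2 := LinearMap.congr_fun (partialTraceRight_sandwich_gram hd L) X
  have h3 := LinearMap.congr_fun (partialTraceRight_sandwich_gram' hd L) X
  rw [LinearMap.comp_apply] at h1 h2 h3
  rw [h1, h2, h3, lindblad_eq_sandwich]
  rfl

lemma isCPTP_partialTraceRight {a b : Type*} [Fintype a] [Fintype b] :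
    IsCPTP (partialTraceRight a b) := ⟨isCP_partialTraceRight, trace_partialTraceRight⟩

lemma isCPTP_appendState (L : Matrix (Fin d) (Fin d) ℂ) (hL : frobNorm L = 1) :
    IsCPTP (appendState (a := Fin d) (programState L)) :=
  ⟨isCP_appendState (posSemidef_programState L), fun X => by
    rw [trace_appendState, trace_programState L hL, mul_one]⟩

lemma isCPTP_wmlStep (L : Matrix (Fin d) (Fin d) ℂ) (hL : frobNorm L = 1) {t : ℝ} (ht : 0 ≤ t) :
    IsCPTP (wmlStep L t) :=
  isCPTP_partialTraceRight.comp ((isCPTP_semigroup_lindblad _ ht).comp (isCPTP_appendState L hL))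

lemma ne_zero_of_frobNorm_eq_one {L : Matrix (Fin d) (Fin d) ℂ} (hL : frobNorm L = 1) : L ≠ 0 := by
  rintro rfl
  simp [frobNorm] at hL

/-- The second derivative of a step. Only the off-diagonal part of `𝓜² (ρ ⊗ π_L)` is large in trace
norm; it is an eigenvector of the semigroup, and its partial trace is small. -/
lemma diamondBound_second_deriv_step (hd : 0 < d) {L : Matrix (Fin d) (Fin d) ℂ}
    (hL : frobNorm L = 1) {t : ℝ} (ht : 0 ≤ t) :
    DiamondBound (partialTraceRight (Fin d) (Fin d × Fin d) ∘ₗ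
      (semigroup (lindblad (wmlJump d)) t * lindblad (wmlJump d) * lindblad (wmlJump d)) ∘ₗ
        appendState (programState L)) (5 * d * opNorm L ^ 2) := by
  have hd0 : (0 : ℝ) < d := by exact_mod_cast hd
  have hl : 0 < opNorm L := opNorm_pos (ne_zero_of_frobNorm_eq_one hL)
  set A := (wmlJump d)ᴴ * wmlJump d * appendKet L with hA
  set B := wmlJump d * appendKet L
  set Tr := partialTraceRight (Fin d) (Fin d × Fin d) with hTr
  set S := semigroup (lindblad (wmlJump d)) t with hS
  have hSA := (sqNormLe_gram_mul_appendKet hd L).diamondBound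
  have hSB := (sqNormLe_wmlJump_mul_appendKet hd L).diamondBound
  have hdecomp : Tr ∘ₗ (S * lindblad (wmlJump d) * lindblad (wmlJump d)) ∘ₗ
        appendState (programState L) =
      (Tr ∘ₗ S) ∘ₗ (lindblad (wmlJump d) ∘ₗ
        (sandwich B B - ((1 / d : ℝ) : ℂ) • sandwich A A)) +
      ((d / 4 * Real.exp (-(d / 2) * t) : ℝ) : ℂ) • (Tr ∘ₗ offDiagonal d L) := by
    ext1 X
    have h := LinearMap.congr_fun (lindblad_appendState L hd) X
    have h2 := semigroup_apply_of_eigenvector (lindblad_offDiagonal hd L X) t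
    change Tr (S (lindblad (wmlJump d) ((lindblad (wmlJump d) ∘ₗ
      appendState (programState L)) X))) = _
    have h3 : lindblad (wmlJump d) (((1 / 2 : ℝ) : ℂ) • offDiagonal d L X) =
        ((-(d / 4) : ℝ) : ℂ) • offDiagonal d L X := by
      rw [map_smul, lindblad_offDiagonal hd, smul_smul, ← Complex.ofReal_mul]
      congr 2
      ring
    rw [h, LinearMap.sub_apply, map_sub, LinearMap.smul_apply, h3, map_sub, map_smul, h2,
      smul_smul, ← Complex.ofReal_mul, map_sub, map_smul, neg_mul, Complex.ofReal_neg, neg_smul,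
      sub_neg_eq_add]
    rfl
  have h1 : DiamondBound (sandwich B B - ((1 / d : ℝ) : ℂ) • sandwich A A)
      (2 * opNorm L ^ 2) := by
    refine (hSB.sub (hSA.smul _)).mono (le_of_eq ?_)
    rw [abs_of_pos (by positivity)]
    field_simp
    ring
  have h2 := (diamondBound_lindblad hd0 (sqNormLe_wmlJump hd)
    (sqNormLe_wmlJump_conjTranspose hd)).comp (by positivity) h1
  have h3 := (isCPTP_partialTraceRight.comp
    (isCPTP_semigroup_lindblad (wmlJump d) ht)).diamondBound.comp zero_le_one h2
  have hH : SqNormLe (Lᴴ * L) ((opNorm L ^ 2) ^ 2) := by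
    have := sqNormLe_opNorm Lᴴ
    rw [opNorm_conjTranspose] at this
    rw [sq (opNorm L ^ 2)]
    exact this.mul (by positivity) (sqNormLe_opNorm L)
  have h4 : DiamondBound (Tr ∘ₗ offDiagonal d L) (4 * opNorm L ^ 2) := by
    have : Tr ∘ₗ offDiagonal d L = (sandwich (Lᴴ * L) 1 + sandwich 1 (Lᴴ * L)) -
        ((2 / d : ℝ) : ℂ) • (Tr ∘ₗ sandwich A A) := by
      rw [← partialTraceRight_sandwich_gram hd L, ← partialTraceRight_sandwich_gram' hd L,
        offDiagonal, LinearMap.comp_sub, LinearMap.comp_add, LinearMap.comp_smul]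
    rw [this]
    refine ((diamondBound_cross_one (by positivity) hH).sub
      ((isCPTP_partialTraceRight.diamondBound.comp zero_le_one hSA).smul _)).mono (le_of_eq ?_)
    rw [abs_of_pos (by positivity)]
    field_simp
    ring
  rw [hdecomp]
  refine (h3.add (h4.smul _)).mono ?_
  rw [abs_of_pos (by positivity)]
  have he : Real.exp (-(d / 2) * t) ≤ 1 := by
    rw [Real.exp_le_one_iff]
    nlinarith
  have : d / 4 * Real.exp (-(d / 2) * t) * (4 * opNorm L ^ 2) ≤ d / 4 * 1 * (4 * opNorm L ^ 2) := by
    gcongr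
  linarith

lemma diamondBound_second_deriv_semigroup {L : Matrix (Fin d) (Fin d) ℂ}
    (hL : frobNorm L = 1) {t : ℝ} (ht : 0 ≤ t) :
    DiamondBound (semigroup (lindblad L) t * lindblad L * lindblad L) (4 * opNorm L ^ 2) := by
  have hl : 0 < opNorm L := opNorm_pos (ne_zero_of_frobNorm_eq_one hL)
  have hl1 : opNorm L ≤ 1 := hL ▸ opNorm_le_frobNorm L
  have h0 := sqNormLe_opNorm Lᴴ
  rw [opNorm_conjTranspose] at h0
  have h1 := diamondBound_lindblad (by positivity) (sqNormLe_opNorm L) h0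
  refine (((isCPTP_semigroup_lindblad L ht).diamondBound.comp zero_le_one h1).comp (by positivity)
    h1).mono ?_
  have : opNorm L ^ 2 ≤ 1 := pow_le_one₀ hl.le hl1
  nlinarith [sq_nonneg (opNorm L)]

/-- The linear functional `Φ ↦ tr (W (id ⊗ post ∘ Φ ∘ pre)(ρ))` on superoperators. -/
noncomputable def testFunctional {a b c : Type*} [Fintype a] [Fintype b] {k : ℕ}
    (W : Matrix (Fin k × b) (Fin k × b) ℂ) (ρ : Matrix (Fin k × c) (Fin k × c) ℂ)
    (post : Matrix a a ℂ →ₗ[ℂ] Matrix b b ℂ) (pre : Matrix c c ℂ →ₗ[ℂ] Matrix a a ℂ) :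
    Module.End ℂ (Matrix a a ℂ) →ₗ[ℂ] ℂ where
  toFun Φ := (W * ampliate (Fin k) (post ∘ₗ Φ ∘ₗ pre) ρ).trace
  map_add' Φ Ψ := by
    rw [LinearMap.add_comp, LinearMap.comp_add, ampliate_add_left, mul_add, Matrix.trace_add]
  map_smul' z Φ := by
    rw [LinearMap.smul_comp, LinearMap.comp_smul, ampliate_smul_left, Matrix.mul_smul,
      Matrix.trace_smul, RingHom.id_apply]

lemma hasDerivAt_semigroup_mul {a : Type*} [Fintype a] [DecidableEq a]
    (𝒢 ℱ : Module.End ℂ (Matrix a a ℂ)) (ψ : Module.End ℂ (Matrix a a ℂ) →ₗ[ℂ] ℂ) (t : ℝ) :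
    HasDerivAt (fun s : ℝ => (ψ (semigroup 𝒢 s * ℱ)).re) (ψ (semigroup 𝒢 t * 𝒢 * ℱ)).re t := by
  have h := hasDerivAt_semigroup 𝒢 (ψ ∘ₗ LinearMap.mulRight ℂ ℱ) t
  exact (Complex.reCLM.hasFDerivAt.comp_hasDerivAt t h)

/-- The error of a single step is quadratic in its length: the error and its first derivative
vanish at `t = 0`, and its second derivative is bounded. -/
lemma diamondBound_wmlStep_sub (hd : 0 < d) {L : Matrix (Fin d) (Fin d) ℂ} (hL : frobNorm L = 1)
    {t : ℝ} (ht : 0 ≤ t) : DiamondBound (wmlStep L t - semigroup (lindblad L) t)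
      (9 / 2 * d * opNorm L ^ 2 * t ^ 2) := by
  have hd1 : (1 : ℝ) ≤ d := by exact_mod_cast hd
  intro k ρ hρ
  refine hasJordanBound_of_forall_contraction ?_ fun W hW => ?_
  · rw [ampliate_sub_left]
    exact ((isCPTP_wmlStep L hL ht).1 k ρ hρ).1.sub ((isCPTP_semigroup_lindblad L ht).1 k ρ hρ).1
  set ψ := testFunctional W ρ (partialTraceRight (Fin d) (Fin d × Fin d))
    (appendState (programState L)) with hψ
  set χ : Module.End ℂ (Matrix (Fin d) (Fin d) ℂ) →ₗ[ℂ] ℂ :=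
    testFunctional W ρ LinearMap.id LinearMap.id with hχ
  have hψ' : ∀ Φ, ψ Φ = (W * ampliate (Fin k) (partialTraceRight (Fin d) (Fin d × Fin d) ∘ₗ Φ ∘ₗ
    appendState (programState L)) ρ).trace := fun _ => rfl
  have hχ' : ∀ Φ, χ Φ = (W * ampliate (Fin k) Φ ρ).trace := fun _ => rfl
  set M := lindblad (wmlJump d)
  set G := lindblad L
  have key := le_of_second_deriv_le
    (g := fun s => (ψ (semigroup M s * 1)).re - (χ (semigroup G s * 1)).re)
    (g' := fun s => (ψ (semigroup M s * (M * 1))).re - (χ (semigroup G s * (G * 1))).re)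
    (g'' := fun s => (ψ (semigroup M s * M * (M * 1))).re - (χ (semigroup G s * G * (G * 1))).re)
    (x := 9 * d * opNorm L ^ 2 * ρ.trace.re)
    (fun s => by
      have := (hasDerivAt_semigroup_mul M 1 ψ s).sub (hasDerivAt_semigroup_mul G 1 χ s)
      rwa [mul_assoc, mul_assoc] at this)
    (fun s => (hasDerivAt_semigroup_mul M (M * 1) ψ s).sub
      (hasDerivAt_semigroup_mul G (G * 1) χ s))
    (by
      have : partialTraceRight (Fin d) (Fin d × Fin d) ∘ₗ
          (1 : Module.End ℂ (Matrix (Fin d × Fin d × Fin d) (Fin d × Fin d × Fin d) ℂ)) ∘ₗ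
          appendState (programState L) = LinearMap.id := partialTraceRight_appendState L hL
      simp only [semigroup_zero, mul_one, hψ', hχ', this]
      exact sub_self _)
    (by
      simp only [semigroup_zero, mul_one, one_mul, hψ', hχ', M,
        partialTraceRight_lindblad_appendState hd L]
      exact sub_self _)
    -- The two second derivatives contribute `5 d ‖L‖²` and `4 ‖L‖² ≤ 4 d ‖L‖²`.
    (fun s hs => by
      have h1 := (diamondBound_second_deriv_step hd hL hs k ρ hρ).re_trace_mul_le hW
      have h2 := (diamondBound_second_deriv_semigroup hL hs k ρ hρ).neg.re_trace_mul_le hW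
      rw [mul_neg, Matrix.trace_neg, Complex.neg_re] at h2
      simp only [mul_one, hψ', hχ']
      have h3 : 4 * opNorm L ^ 2 * ρ.trace.re ≤ 4 * (d * opNorm L ^ 2) * ρ.trace.re := by
        have := re_trace_nonneg hρ
        gcongr
        nlinarith [sq_nonneg (opNorm L)]
      linarith) ht
  simp only [mul_one, hψ', hχ'] at key
  rw [ampliate_sub_left, mul_sub, Matrix.trace_sub, Complex.sub_re, wmlStep_eq]
  refine key.trans (le_of_eq (by ring))

end Step

/-! ### From the single step to the sample complexities -/

section Complexity

variable {a b : Type*} [Fintype b]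

/-- Splits the first of `n + 1` program registers off. -/
def splitRegister (a b : Type*) (n : ℕ) : (a × b) × (Fin n → b) ≃ a × (Fin (n + 1) → b) :=
  (Equiv.prodAssoc a b (Fin n → b)).trans
    ((Equiv.refl a).prodCongr (Fin.consEquiv fun _ => b))

/-- Consumes the `n` program registers one after the other, each by the channel `T`. -/
def iterateProgram (T : Matrix (a × b) (a × b) ℂ →ₗ[ℂ] Matrix a a ℂ) :
    (n : ℕ) → Matrix (a × (Fin n → b)) (a × (Fin n → b)) ℂ →ₗ[ℂ] Matrix a a ℂ
  | 0 => partialTraceRight a (Fin 0 → b)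
  | n + 1 => iterateProgram T n ∘ₗ tensorId (Fin n → b) T ∘ₗ pullback (splitRegister a b n)

lemma isCPTP_iterateProgram [Fintype a] {T : Matrix (a × b) (a × b) ℂ →ₗ[ℂ] Matrix a a ℂ}
    (hT : IsCPTP T) (n : ℕ) : IsCPTP (iterateProgram T n) := by
  induction n with
  | zero => exact isCPTP_partialTraceRight
  | succ n ih =>
    exact ih.comp (IsCPTP.comp ⟨IsCP.tensorId hT.1, trace_tensorId hT.2⟩
      ⟨isCP_pullback _, trace_pullback _⟩)

lemma iterateProgram_appendState (T : Matrix (a × b) (a × b) ℂ →ₗ[ℂ] Matrix a a ℂ)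
    (κ : Matrix b b ℂ) (n : ℕ) :
    iterateProgram T n ∘ₗ appendState (tensorPower κ n) = (T ∘ₗ appendState κ) ^ n := by
  induction n with
  | zero =>
    ext1 X
    ext i j
    change ∑ s : Fin 0 → b, X i j * ∏ l : Fin 0, κ (s l) (s l) = X i j
    simp
  | succ n ih =>
    rw [pow_succ, ← ih]
    change _ = (iterateProgram T n ∘ₗ appendState (tensorPower κ n)) ∘ₗ (T ∘ₗ appendState κ)
    ext1 X
    have h : tensorId (Fin n → b) T (pullback (splitRegister a b n)
        (appendState (tensorPower κ (n + 1)) X)) =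
        appendState (tensorPower κ n) (T (appendState κ X)) := by
      ext ⟨i, x⟩ ⟨j, y⟩
      have h1 : (Matrix.of fun p q : a × b => (pullback (splitRegister a b n)
          (appendState (tensorPower κ (n + 1)) X)) (p, x) (q, y)) =
          (tensorPower κ n x y) • appendState κ X := by
        ext ⟨i, s⟩ ⟨j, r⟩
        change X i j * ∏ l, κ (Fin.cons (α := fun _ => b) s x l)
          (Fin.cons (α := fun _ => b) r y l) = (∏ l, κ (x l) (y l)) * (X i j * κ s r)
        rw [Fin.prod_univ_succ]
        simp only [Fin.cons_zero, Fin.cons_succ]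
        ring
      change T (Matrix.of fun p q : a × b => (pullback (splitRegister a b n)
          (appendState (tensorPower κ (n + 1)) X)) (p, x) (q, y)) i j = _
      rw [h1, map_smul]
      exact mul_comm _ _
    change iterateProgram T n (tensorId (Fin n → b) T (pullback (splitRegister a b n)
        (appendState (tensorPower κ (n + 1)) X))) = _
    rw [h]
    rfl

variable {d : ℕ}

/-- The error of the algorithm with `n` steps. -/
lemma diamondDist_wmlStep_pow_le (hd : 0 < d) {L : Matrix (Fin d) (Fin d) ℂ} (hL : frobNorm L = 1)
    {t ε : ℝ} (ht : 0 ≤ t) (hε : 0 < ε) {n : ℕ}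
    (hn : 9 / 4 * (d * opNorm L ^ 2) * (t ^ 2 / ε) ≤ n) :
    diamondDist (wmlStep L (t / n) ^ n) (semigroup (lindblad L) t) ≤ ENNReal.ofReal ε := by
  have hl : 0 < opNorm L := opNorm_pos (ne_zero_of_frobNorm_eq_one hL)
  have hd0 : (0 : ℝ) < d := by exact_mod_cast hd
  have hn' : 9 / 4 * (d * opNorm L ^ 2) * t ^ 2 ≤ n * ε := by
    rwa [← mul_div_assoc, div_le_iff₀ hε] at hn
  refine DiamondBound.diamondDist_le ?_
  rcases Nat.eq_zero_or_pos n with rfl | hn0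
  -- No step is needed only if `t = 0`, where both maps are the identity.
  · have ht0 : t = 0 := by
      by_contra h
      have : 0 < t := lt_of_le_of_ne ht (Ne.symm h)
      have : 0 < 9 / 4 * (d * opNorm L ^ 2) * t ^ 2 := by positivity
      simp only [Nat.cast_zero, zero_mul] at hn'
      linarith
    have h0 := DiamondBound.pow_sub_pow (isCPTP_wmlStep L hL le_rfl)
      (isCPTP_semigroup_lindblad L le_rfl) (by positivity)
      (diamondBound_wmlStep_sub hd hL le_rfl) 0
    rw [ht0, semigroup_zero]
    simp only [pow_zero] at h0 ⊢
    refine h0.mono ?_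
    simp only [Nat.cast_zero, zero_mul]
    linarith
  · have hn1 : (0 : ℝ) < n := by exact_mod_cast hn0
    have htn : 0 ≤ t / n := by positivity
    rw [← semigroup_div_pow (lindblad L) t hn0.ne']
    refine (DiamondBound.pow_sub_pow (isCPTP_wmlStep L hL htn) (isCPTP_semigroup_lindblad L htn)
      (by positivity) (diamondBound_wmlStep_sub hd hL htn) n).mono ?_
    have : n * (9 / 2 * d * opNorm L ^ 2 * (t / n) ^ 2) =
        2 * (9 / 4 * (d * opNorm L ^ 2) * t ^ 2) / n := by
      field_simp
      ring
    rw [this, div_le_iff₀ hn1]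
    linarith

variable {Ω : Type*} [MeasurableSpace Ω]

/-- Both sample complexities are controlled by a high-probability bound on `d ‖L‖_∞²`. -/
lemma sampleComplexities_le (hd : 0 < d) {μ : Measure Ω} {L : Ω → Matrix (Fin d) (Fin d) ℂ}
    (hL : ∀ ω, frobNorm (L ω) = 1) {t ε δ x : ℝ} (ht : 0 ≤ t) (hε : 0 < ε)
    (hx : ENNReal.ofReal (1 - δ) ≤ μ {ω | d * opNorm (L ω) ^ 2 ≤ x}) {n : ℕ}
    (hn : 9 / 4 * x * (t ^ 2 / ε) ≤ n) :
    typicalSampleComplexity μ L t ε δ ≤ n ∧ typicalWMLComplexity μ L t ε δ ≤ n := by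
  have key : {ω | d * opNorm (L ω) ^ 2 ≤ x} ⊆ {ω | diamondDist (wmlStep (L ω) (t / n) ^ n)
      (semigroup (lindblad (L ω)) t) ≤ ENNReal.ofReal ε} := fun ω hω =>
    diamondDist_wmlStep_pow_le hd (hL ω) ht hε (le_trans (by
      have : (d : ℝ) * opNorm (L ω) ^ 2 ≤ x := hω
      gcongr) hn)
  have htn : 0 ≤ t / n := by positivity
  have h := hx.trans (measure_mono key)
  refine ⟨iInf₂_le n ⟨iterateProgram (partialTraceRight (Fin d) (Fin d × Fin d) ∘ₗ
    semigroup (lindblad (wmlJump d)) (t / n)) n, ?_, ?_⟩,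
    iInf₂_le n h⟩
  · exact isCPTP_iterateProgram (isCPTP_partialTraceRight.comp
      (isCPTP_semigroup_lindblad _ htn)) n
  · simp only [iterateProgram_appendState]
    exact h

end Complexity

/-! ### Subgaussian entries and nets -/

section Entries

variable {Ω : Type*} [MeasurableSpace Ω] {μ : Measure Ω}

lemma lintegral_exp_le_of_psi2Norm_lt {X : Ω → ℂ} {κ : ℝ}
    (h : psi2Norm μ X < ENNReal.ofReal κ) :
    ∫⁻ ω, ENNReal.ofReal (Real.exp (‖X ω‖ ^ 2 / κ ^ 2)) ∂μ ≤ 2 := by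
  simp only [psi2Norm, iInf_lt_iff] at h
  obtain ⟨s, ⟨hs0, hs⟩, hsκ⟩ := h
  have hsκ : s ≤ κ := ((ENNReal.ofReal_lt_ofReal_iff_of_nonneg hs0.le).1 hsκ).le
  refine (lintegral_mono fun ω => ENNReal.ofReal_le_ofReal (Real.exp_le_exp.2 ?_)).trans hs
  gcongr

/-- `X` is measurable and `𝔼 exp (|X|² / κ²) ≤ 2`, with the integrability that turns this into a
statement on Bochner integrals. -/
structure ExpSqMoment (μ : Measure Ω) (X : Ω → ℂ) (κ : ℝ) : Prop where
  pos : 0 < κ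
  measurable : Measurable X
  integrable : Integrable (fun ω => Real.exp (‖X ω‖ ^ 2 / κ ^ 2)) μ
  integral_le : ∫ ω, Real.exp (‖X ω‖ ^ 2 / κ ^ 2) ∂μ ≤ 2

lemma expSqMoment_of_psi2Norm_lt {X : Ω → ℂ} (hX : Measurable X) {κ : ℝ} (hκ : 0 < κ)
    (h : psi2Norm μ X < ENNReal.ofReal κ) : ExpSqMoment μ X κ := by
  have h2 := lintegral_exp_le_of_psi2Norm_lt h
  have hm : Measurable fun ω => Real.exp (‖X ω‖ ^ 2 / κ ^ 2) := by fun_prop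
  have hi : Integrable (fun ω => Real.exp (‖X ω‖ ^ 2 / κ ^ 2)) μ := by
    refine ⟨hm.aestronglyMeasurable, ?_⟩
    rw [hasFiniteIntegral_iff_ofReal (Filter.Eventually.of_forall fun ω => (Real.exp_pos _).le)]
    exact lt_of_le_of_lt h2 (by norm_num)
  refine ⟨hκ, hX, hi, ?_⟩
  rw [← ENNReal.ofReal_le_ofReal_iff (by norm_num), ofReal_integral_eq_lintegral_ofReal hi
    (Filter.Eventually.of_forall fun ω => (Real.exp_pos _).le)]
  simpa using h2

lemma exp_le_add_exp_sq (y : ℝ) : Real.exp y ≤ y + Real.exp (y ^ 2) := by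
  rcases le_or_gt |y| 1 with h | h
  · have h1 := (abs_le.1 (Real.abs_exp_sub_one_sub_id_le h)).2
    have h2 := Real.add_one_le_exp (y ^ 2)
    linarith
  · rcases lt_or_ge 0 y with hy | hy
    · rw [abs_of_pos hy] at h
      have : Real.exp y ≤ Real.exp (y ^ 2) := Real.exp_le_exp.2 (by nlinarith)
      linarith
    · rw [abs_of_nonpos hy] at h
      have h1 : Real.exp y ≤ 1 := Real.exp_le_one_iff.2 hy
      have h2 := Real.add_one_le_exp (y ^ 2)
      nlinarith

lemma exp_mul_le_one_add {p : ℝ} (hp : 0 ≤ p) (hp1 : p ≤ 1) (x : ℝ) :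
    Real.exp (p * x) ≤ 1 + p * (Real.exp x - 1) := by
  have := convexOn_exp.2 (Set.mem_univ 0) (Set.mem_univ x) (sub_nonneg.2 hp1) hp (by ring)
  simp only [smul_eq_mul, mul_zero, zero_add, Real.exp_zero, mul_one] at this
  linarith

variable {X : Ω → ℂ} {κ : ℝ}

lemma re_mul_le (hκ : 0 < κ) (z w : ℂ) :
    (z * w).re ≤ κ ^ 2 * ‖z‖ ^ 2 / 2 + 1 / 2 * (‖w‖ ^ 2 / κ ^ 2) := by
  have h1 : (z * w).re ≤ ‖z‖ * ‖w‖ := (Complex.re_le_norm _).trans (norm_mul z w).le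
  have h2 : ‖z‖ * ‖w‖ = (κ * ‖z‖) * (‖w‖ / κ) := by field_simp
  have h3 : κ ^ 2 * ‖z‖ ^ 2 / 2 + 1 / 2 * (‖w‖ ^ 2 / κ ^ 2) =
      ((κ * ‖z‖) ^ 2 + (‖w‖ / κ) ^ 2) / 2 := by
    rw [mul_pow, div_pow]
    ring
  rw [h3]
  nlinarith [sq_nonneg (κ * ‖z‖ - ‖w‖ / κ)]

lemma ExpSqMoment.integrable_exp_re_mul [IsProbabilityMeasure μ] (h : ExpSqMoment μ X κ) (z : ℂ) :
    Integrable (fun ω => Real.exp ((z * X ω).re)) μ := by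
  have hX := h.measurable
  refine (h.integrable.const_mul (Real.exp (κ ^ 2 * ‖z‖ ^ 2 / 2))).mono'
    (by fun_prop) (Filter.Eventually.of_forall fun ω => ?_)
  rw [Real.norm_of_nonneg (Real.exp_pos _).le, ← Real.exp_add, Real.exp_le_exp]
  refine (re_mul_le h.pos z (X ω)).trans ?_
  have : 0 ≤ ‖X ω‖ ^ 2 / κ ^ 2 := by positivity
  linarith

lemma ExpSqMoment.integrable_sq (h : ExpSqMoment μ X κ) : Integrable (fun ω => ‖X ω‖ ^ 2) μ := by
  have hX := h.measurable
  have hκ := h.pos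
  refine (h.integrable.const_mul (κ ^ 2)).mono' (by fun_prop)
    (Filter.Eventually.of_forall fun ω => ?_)
  rw [Real.norm_of_nonneg (by positivity)]
  have := Real.add_one_le_exp (‖X ω‖ ^ 2 / κ ^ 2)
  rw [← div_le_iff₀' (by positivity)]
  linarith

lemma ExpSqMoment.integrable_self [IsProbabilityMeasure μ] (h : ExpSqMoment μ X κ) :
    Integrable X μ := by
  refine (h.integrable_sq.add (integrable_const 1)).mono' h.measurable.aestronglyMeasurable
    (Filter.Eventually.of_forall fun ω => ?_)
  simp only [Pi.add_apply]
  nlinarith [sq_nonneg (‖X ω‖ - 1)]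

/-- The moment generating function of a centered variable. Weak coefficients are treated by
`exp y ≤ y + exp (y²)`, where the linear term has mean zero, strong ones by completing the
square. -/
lemma ExpSqMoment.integral_exp_re_mul_le [IsProbabilityMeasure μ] (h : ExpSqMoment μ X κ)
    (h0 : ∫ ω, X ω ∂μ = 0) (z : ℂ) :
    ∫ ω, Real.exp ((z * X ω).re) ∂μ ≤ Real.exp (κ ^ 2 * ‖z‖ ^ 2) := by
  have hκ := h.pos
  have hX := h.measurable
  set p := κ ^ 2 * ‖z‖ ^ 2 with hp
  have hp0 : 0 ≤ p := by positivity
  have hE := h.integrable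
  have hlin : ∀ q : ℝ, ∫ ω, (1 + q * (Real.exp (‖X ω‖ ^ 2 / κ ^ 2) - 1)) ∂μ =
      1 + q * (∫ ω, Real.exp (‖X ω‖ ^ 2 / κ ^ 2) ∂μ - 1) := fun q => by
    have hE1 : Integrable (fun ω => Real.exp (‖X ω‖ ^ 2 / κ ^ 2) - 1) μ :=
      hE.sub (integrable_const _)
    rw [integral_add (integrable_const _) (hE1.const_mul _), integral_const_mul,
      integral_sub hE (integrable_const _)]
    simp
  have hlini : ∀ q : ℝ, Integrable (fun ω => 1 + q * (Real.exp (‖X ω‖ ^ 2 / κ ^ 2) - 1)) μ :=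
    fun q => (integrable_const _).add ((hE.sub (integrable_const _)).const_mul _)
  have hq : ∀ q : ℝ, 0 ≤ q →
      1 + q * (∫ ω, Real.exp (‖X ω‖ ^ 2 / κ ^ 2) ∂μ - 1) ≤ Real.exp q := fun q hq => by
    have := Real.add_one_le_exp q
    nlinarith [h.integral_le]
  rcases le_total p 1 with hp1 | hp1
  · have hmean : ∫ ω, (z * X ω).re ∂μ = 0 := by
      have h1 := integral_re (𝕜 := ℂ) (h.integrable_self.const_mul z)
      rw [integral_const_mul, h0, mul_zero] at h1
      simpa using h1
    have hmi : Integrable (fun ω => (z * X ω).re) μ := (h.integrable_self.const_mul z).re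
    calc ∫ ω, Real.exp ((z * X ω).re) ∂μ
        ≤ ∫ ω, ((z * X ω).re + (1 + p * (Real.exp (‖X ω‖ ^ 2 / κ ^ 2) - 1))) ∂μ := by
          refine integral_mono (h.integrable_exp_re_mul z) (hmi.add (hlini p)) fun ω => ?_
          refine (exp_le_add_exp_sq _).trans (add_le_add_right ?_ _)
          refine le_trans (Real.exp_le_exp.2 ?_) (exp_mul_le_one_add hp0 hp1 _)
          have h1 : p * (‖X ω‖ ^ 2 / κ ^ 2) = ‖z * X ω‖ ^ 2 := by
            rw [hp, norm_mul]
            field_simp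
          rw [h1]
          exact sq_le_sq' (neg_le_of_abs_le (Complex.abs_re_le_norm _)) (Complex.re_le_norm _)
      _ = 1 + p * (∫ ω, Real.exp (‖X ω‖ ^ 2 / κ ^ 2) ∂μ - 1) := by
          rw [integral_add hmi (hlini p), hmean, hlin, zero_add]
      _ ≤ Real.exp p := hq p hp0
  · calc ∫ ω, Real.exp ((z * X ω).re) ∂μ
        ≤ ∫ ω, Real.exp (p / 2) * (1 + 1 / 2 * (Real.exp (‖X ω‖ ^ 2 / κ ^ 2) - 1)) ∂μ := by
          refine integral_mono (h.integrable_exp_re_mul z) ((hlini _).const_mul _) fun ω => ?_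
          refine (Real.exp_le_exp.2 (re_mul_le hκ z (X ω))).trans ?_
          rw [Real.exp_add]
          exact mul_le_mul_of_nonneg_left
            (exp_mul_le_one_add (by norm_num) (by norm_num) _) (Real.exp_pos _).le
      _ = Real.exp (p / 2) * (1 + 1 / 2 * (∫ ω, Real.exp (‖X ω‖ ^ 2 / κ ^ 2) ∂μ - 1)) := by
          rw [integral_const_mul, hlin]
      _ ≤ Real.exp (p / 2) * Real.exp (1 / 2) :=
          mul_le_mul_of_nonneg_left (hq _ (by norm_num)) (Real.exp_pos _).le
      _ ≤ Real.exp p := by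
          rw [← Real.exp_add, Real.exp_le_exp]
          linarith

lemma ExpSqMoment.hasSubgaussianMGF [IsProbabilityMeasure μ] (h : ExpSqMoment μ X κ)
    (h0 : ∫ ω, X ω ∂μ = 0) (z : ℂ) :
    HasSubgaussianMGF (fun ω => (z * X ω).re) (Real.toNNReal (2 * κ ^ 2 * ‖z‖ ^ 2)) μ := by
  have he : ∀ (t : ℝ) ω, t * (z * X ω).re = ((t * z) * X ω).re := fun t ω => by
    rw [mul_assoc, Complex.re_ofReal_mul]
  refine ⟨fun t => ?_, fun t => ?_⟩
  · simp only [he]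
    exact h.integrable_exp_re_mul _
  · simp only [mgf, he]
    refine (h.integral_exp_re_mul_le h0 _).trans (le_of_eq ?_)
    rw [Real.coe_toNNReal _ (by positivity), norm_mul, Complex.norm_real, mul_pow, Real.norm_eq_abs,
      sq_abs]
    congr 1
    ring

/-- The Laplace transform of the square of a variable of unit variance. -/
lemma ExpSqMoment.mgf_sq_le [IsProbabilityMeasure μ] (h : ExpSqMoment μ X κ)
    (h1 : ∫ ω, ‖X ω‖ ^ 2 ∂μ = 1) {θ : ℝ} (hθ : 0 ≤ θ) :
    mgf (fun ω => ‖X ω‖ ^ 2) μ (-θ) ≤ Real.exp (-θ + 4 * κ ^ 4 * θ ^ 2) := by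
  have hκ := h.pos
  have hX := h.measurable
  have hi1 : Integrable (fun ω => 1 - θ * ‖X ω‖ ^ 2) μ :=
    (integrable_const _).sub (h.integrable_sq.const_mul θ)
  have hi2 : Integrable (fun ω => 2 * κ ^ 4 * θ ^ 2 * Real.exp (‖X ω‖ ^ 2 / κ ^ 2)) μ :=
    h.integrable.const_mul _
  have hb : ∀ ω, Real.exp (-θ * ‖X ω‖ ^ 2) ≤
      (1 - θ * ‖X ω‖ ^ 2) + 2 * κ ^ 4 * θ ^ 2 * Real.exp (‖X ω‖ ^ 2 / κ ^ 2) := fun ω => by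
    set u := ‖X ω‖ ^ 2 with hu
    have hu0 : 0 ≤ u := by positivity
    have h2 : Real.exp (-θ * u) ≤ 1 - θ * u + (θ * u) ^ 2 := by
      rcases le_total (θ * u) 1 with h | h
      · have h0 : 0 ≤ θ * u := by positivity
        have := (abs_le.1 (Real.abs_exp_sub_one_sub_id_le (x := -θ * u) (by
          rw [neg_mul, abs_neg, abs_of_nonneg h0]
          exact h))).2
        nlinarith
      · have : Real.exp (-θ * u) ≤ 1 := Real.exp_le_one_iff.2 (by nlinarith)
        nlinarith
    have h3 : u ^ 2 ≤ 2 * κ ^ 4 * Real.exp (u / κ ^ 2) := by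
      have h4 := Real.quadratic_le_exp_of_nonneg (x := u / κ ^ 2) (by positivity)
      have h5 : 0 ≤ u / κ ^ 2 := by positivity
      have h6 : u ^ 2 = 2 * κ ^ 4 * ((u / κ ^ 2) ^ 2 / 2) := by field_simp
      rw [h6]
      refine mul_le_mul_of_nonneg_left ?_ (by positivity)
      linarith
    nlinarith [mul_le_mul_of_nonneg_left h3 (sq_nonneg θ)]
  calc mgf (fun ω => ‖X ω‖ ^ 2) μ (-θ)
      ≤ ∫ ω, ((1 - θ * ‖X ω‖ ^ 2) + 2 * κ ^ 4 * θ ^ 2 * Real.exp (‖X ω‖ ^ 2 / κ ^ 2)) ∂μ :=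
        integral_mono_of_nonneg (Filter.Eventually.of_forall fun ω => (Real.exp_pos _).le)
          (hi1.add hi2) (Filter.Eventually.of_forall hb)
    _ = (1 - θ) + 2 * κ ^ 4 * θ ^ 2 * ∫ ω, Real.exp (‖X ω‖ ^ 2 / κ ^ 2) ∂μ := by
        rw [integral_add hi1 hi2, integral_sub (integrable_const _) (h.integrable_sq.const_mul θ),
          integral_const_mul, integral_const_mul, h1]
        simp
    _ ≤ (1 - θ) + 2 * κ ^ 4 * θ ^ 2 * 2 := by
        have := h.integral_le
        gcongr
    _ ≤ Real.exp (-θ + 4 * κ ^ 4 * θ ^ 2) := by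
        have := Real.add_one_le_exp (-θ + 4 * κ ^ 4 * θ ^ 2)
        linarith

end Entries

section Net

variable {d : ℕ}

/-- The unit ball of `ℂ^d` has a `1/2`-net of at most `5^(2d)` points. -/
lemma exists_net (d : ℕ) : ∃ N : Finset (EuclideanSpace ℂ (Fin d)), (∀ c ∈ N, ‖c‖ ≤ 1) ∧
    N.card ≤ 5 ^ (2 * d) ∧ ∀ x : EuclideanSpace ℂ (Fin d), ‖x‖ ≤ 1 → ∃ c ∈ N, ‖x - c‖ ≤ 1 / 2 := by
  classical
  set P : Finset (EuclideanSpace ℂ (Fin d)) → Prop := fun s =>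
    (∀ c ∈ s, ‖c‖ ≤ 1) ∧ ∀ c ∈ s, ∀ c' ∈ s, c ≠ c' → 1 / 2 ≤ ‖c - c'‖ with hP
  have hfr : Module.finrank ℝ (EuclideanSpace ℂ (Fin d)) = 2 * d := by
    rw [finrank_real_of_complex, finrank_euclideanSpace_fin]
  have hcard : ∀ s, P s → s.card ≤ 5 ^ (2 * d) := fun s hs => by
    have hinj : Function.Injective fun x : EuclideanSpace ℂ (Fin d) => (2 : ℝ) • x :=
      smul_right_injective _ two_ne_zero
    rw [← Finset.card_image_of_injective s hinj, ← hfr]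
    refine Besicovitch.card_le_of_separated _ ?_ ?_
    · simp only [Finset.mem_image, forall_exists_index, and_imp, forall_apply_eq_imp_iff₂]
      intro c hc
      rw [norm_smul, Real.norm_of_nonneg (by norm_num)]
      linarith [hs.1 c hc]
    · simp only [Finset.mem_image, forall_exists_index, and_imp, forall_apply_eq_imp_iff₂]
      intro c hc c' hc' hne
      rw [← smul_sub, norm_smul, Real.norm_of_nonneg (by norm_num)]
      linarith [hs.2 c hc c' hc' fun h => hne (by rw [h])]
  -- A separated set of maximal cardinality is a net.
  obtain ⟨N, hN, hmax⟩ : ∃ N, P N ∧ ∀ s, P s → s.card ≤ N.card := by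
    have hne : {n | ∃ s, P s ∧ s.card = n}.Nonempty := ⟨0, ∅, by simp [hP], rfl⟩
    have hbdd : BddAbove {n | ∃ s, P s ∧ s.card = n} := ⟨5 ^ (2 * d), by
      rintro _ ⟨s, hs, rfl⟩
      exact hcard s hs⟩
    obtain ⟨N, hN, hNc⟩ := Nat.sSup_mem hne hbdd
    exact ⟨N, hN, fun s hs => hNc ▸ le_csSup hbdd ⟨s, hs, rfl⟩⟩
  refine ⟨N, hN.1, hcard N hN, fun x hx => ?_⟩
  by_contra! hfar
  have hxN : x ∉ N := fun h => by
    have := hfar x h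
    simp at this
    linarith
  have hins : P (insert x N) := by
    refine ⟨fun c hc => ?_, fun c hc c' hc' hne => ?_⟩
    · rcases Finset.mem_insert.1 hc with rfl | hc
      · exact hx
      · exact hN.1 c hc
    · rcases Finset.mem_insert.1 hc with h | h <;> rcases Finset.mem_insert.1 hc' with h' | h'
      · exact absurd (h.trans h'.symm) hne
      · exact h ▸ (hfar c' h').le
      · rw [norm_sub_rev]
        exact h' ▸ (hfar c h).le
      · exact hN.2 c h c' h' hne
  have := hmax _ hins
  rw [Finset.card_insert_of_notMem hxN] at this
  omega

/-- The operator norm is controlled by the values of the sesquilinear form on a net. -/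
lemma opNorm_le_of_net {N : Finset (EuclideanSpace ℂ (Fin d))}
    (hN : ∀ x : EuclideanSpace ℂ (Fin d), ‖x‖ ≤ 1 → ∃ c ∈ N, ‖x - c‖ ≤ 1 / 2)
    (A : Matrix (Fin d) (Fin d) ℂ) {s : ℝ} (hs : 0 ≤ s)
    (h : ∀ x ∈ N, ∀ y ∈ N,
      (inner ℂ y (Matrix.toEuclideanCLM (n := Fin d) (𝕜 := ℂ) A x)).re ≤ s) :
    opNorm A ≤ 4 * s := by
  set T := Matrix.toEuclideanCLM (n := Fin d) (𝕜 := ℂ) A with hT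
  have h1 : ∀ x ∈ N, ‖T x‖ ≤ 2 * s := fun x hx => by
    rcases eq_or_ne (T x) 0 with h0 | h0
    · rw [h0, norm_zero]
      positivity
    have hn : 0 < ‖T x‖ := norm_pos_iff.2 h0
    set u : EuclideanSpace ℂ (Fin d) := ((‖T x‖⁻¹ : ℝ) : ℂ) • T x with hu
    have hu1 : ‖u‖ = 1 := by
      rw [hu, norm_smul, Complex.norm_real, norm_inv, norm_norm, inv_mul_cancel₀ hn.ne']
    obtain ⟨y, hy, hyu⟩ := hN u hu1.le
    have h2 : (inner ℂ u (T x)).re = ‖T x‖ := by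
      have h3 : (inner ℂ (T x) (T x)).re = ‖T x‖ ^ 2 := inner_self_eq_norm_sq (𝕜 := ℂ) (T x)
      rw [hu, inner_smul_left, Complex.conj_ofReal, Complex.re_ofReal_mul, h3]
      field_simp
    have h3 : (inner ℂ (u - y) (T x)).re ≤ 1 / 2 * ‖T x‖ :=
      (Complex.re_le_norm _).trans ((norm_inner_le_norm _ _).trans (by gcongr))
    rw [inner_sub_left, Complex.sub_re, h2] at h3
    linarith [h x hx y hy]
  have h2 : opNorm A ≤ 2 * s + opNorm A / 2 := by
    refine ContinuousLinearMap.opNorm_le_of_unit_norm (by have := opNorm_nonneg A; positivity)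
      fun x hx => ?_
    obtain ⟨c, hc, hxc⟩ := hN x hx.le
    have h3 : T x = T c + T (x - c) := by rw [← map_add]; congr 1; abel
    change ‖T x‖ ≤ _
    rw [h3]
    refine (norm_add_le _ _).trans (add_le_add (h1 c hc) ?_)
    refine (T.le_opNorm _).trans ?_
    change opNorm A * _ ≤ _
    have := opNorm_nonneg A
    nlinarith
  linarith

end Net

/-! ### Concentration of the normalized operator norm -/

section Ensemble

variable {Ω : Type*} [MeasurableSpace Ω] {μ : Measure Ω} [IsProbabilityMeasure μ] {d : ℕ}
  {L' L : Ω → Matrix (Fin d) (Fin d) ℂ} {K κ : ℝ}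

omit [IsProbabilityMeasure μ] in
/-- The infimum in `psi2Norm` need not be attained, so `K` is replaced by a larger number; taking it
at least `1` also covers `K ≤ 0`. -/
lemma IsSubgaussianEnsemble.expSqMoment (h : IsSubgaussianEnsemble μ L' K) (i j : Fin d) :
    ExpSqMoment μ (fun ω => L' ω i j) (max K 0 + 1) := by
  have hκ : 0 < max K 0 + 1 := by have := le_max_right K 0; linarith
  refine expSqMoment_of_psi2Norm_lt (h.measurable i j) hκ ((h.subgaussian i j).trans_lt ?_)
  rw [ENNReal.ofReal_lt_ofReal_iff hκ]
  have := le_max_left K 0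
  linarith

lemma re_inner_toEuclideanCLM (A : Matrix (Fin d) (Fin d) ℂ) (x y : EuclideanSpace ℂ (Fin d)) :
    (inner ℂ y (Matrix.toEuclideanCLM (n := Fin d) (𝕜 := ℂ) A x)).re =
      ∑ p : Fin d × Fin d, ((starRingEnd ℂ (y p.1) * x p.2) * A p.1 p.2).re := by
  rw [← Complex.re_sum, Fintype.sum_prod_type, PiLp.inner_apply]
  congr 1
  refine Finset.sum_congr rfl fun i _ => ?_
  rw [RCLike.inner_apply]
  change (A *ᵥ x.ofLp) i * _ = _
  rw [Matrix.mulVec, dotProduct, Finset.sum_mul]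
  exact Finset.sum_congr rfl fun j _ => by ring

/-- The sesquilinear form of the ensemble at two fixed vectors is subgaussian. -/
lemma measure_re_inner_ge_le (hind : iIndepFun (fun (p : Fin d × Fin d) ω => L' ω p.1 p.2) μ)
    (h0 : ∀ i j, ∫ ω, L' ω i j ∂μ = 0) (hL : ∀ i j, ExpSqMoment μ (fun ω => L' ω i j) κ)
    {x y : EuclideanSpace ℂ (Fin d)} (hx : ‖x‖ ≤ 1) (hy : ‖y‖ ≤ 1) {s : ℝ} (hs : 0 ≤ s) :
    μ.real {ω | s ≤ (inner ℂ y (Matrix.toEuclideanCLM (n := Fin d) (𝕜 := ℂ) (L' ω) x)).re} ≤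
      Real.exp (-s ^ 2 / (4 * κ ^ 2)) := by
  simp only [re_inner_toEuclideanCLM]
  have hind' : iIndepFun (fun (p : Fin d × Fin d) ω =>
      ((starRingEnd ℂ (y p.1) * x p.2) * L' ω p.1 p.2).re) μ :=
    hind.comp (fun p w => ((starRingEnd ℂ (y p.1) * x p.2) * w).re) fun p => by fun_prop
  have h1 := HasSubgaussianMGF.sum_of_iIndepFun hind' (s := Finset.univ) fun p _ =>
    (hL p.1 p.2).hasSubgaussianMGF (h0 p.1 p.2) (starRingEnd ℂ (y p.1) * x p.2)
  have hc : ((∑ p : Fin d × Fin d,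
      Real.toNNReal (2 * κ ^ 2 * ‖starRingEnd ℂ (y p.1) * x p.2‖ ^ 2) : NNReal) : ℝ) ≤
      2 * κ ^ 2 := by
    have h2 : ∑ p : Fin d × Fin d, (2 * κ ^ 2 * ‖starRingEnd ℂ (y p.1) * x p.2‖ ^ 2) =
        2 * κ ^ 2 * (‖y‖ ^ 2 * ‖x‖ ^ 2) := by
      rw [EuclideanSpace.norm_sq_eq, EuclideanSpace.norm_sq_eq, Finset.sum_mul_sum,
        ← Finset.mul_sum, Fintype.sum_prod_type]
      simp only [norm_mul, RCLike.norm_conj, mul_pow]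
    rw [NNReal.coe_sum, Finset.sum_congr rfl fun p _ => Real.coe_toNNReal _ (by positivity), h2]
    refine mul_le_of_le_one_right (by positivity) (mul_le_one₀ ?_ (by positivity) ?_)
    · exact pow_le_one₀ (norm_nonneg y) hy
    · exact pow_le_one₀ (norm_nonneg x) hx
  have h3 : HasSubgaussianMGF (fun ω => ∑ p : Fin d × Fin d,
      ((starRingEnd ℂ (y p.1) * x p.2) * L' ω p.1 p.2).re) (Real.toNNReal (2 * κ ^ 2)) μ := by
    refine ⟨h1.integrable_exp_mul, fun t => (h1.mgf_le t).trans (Real.exp_le_exp.2 ?_)⟩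
    rw [Real.coe_toNNReal _ (by positivity)]
    gcongr
  refine (h3.measure_ge_le hs).trans (le_of_eq ?_)
  rw [Real.coe_toNNReal _ (by positivity)]
  congr 2
  ring

/-- The upper tail of the operator norm, by a union bound over a net. -/
lemma measure_opNorm_gt_le (hind : iIndepFun (fun (p : Fin d × Fin d) ω => L' ω p.1 p.2) μ)
    (h0 : ∀ i j, ∫ ω, L' ω i j ∂μ = 0) (hL : ∀ i j, ExpSqMoment μ (fun ω => L' ω i j) κ)
    {s : ℝ} (hs : 0 ≤ s) :
    μ.real {ω | 4 * s < opNorm (L' ω)} ≤ Real.exp (8 * d - s ^ 2 / (4 * κ ^ 2)) := by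
  obtain ⟨N, hN1, hNc, hN⟩ := exists_net d
  have hsub : {ω | 4 * s < opNorm (L' ω)} ⊆ ⋃ p ∈ N ×ˢ N,
      {ω | s ≤ (inner ℂ p.2 (Matrix.toEuclideanCLM (n := Fin d) (𝕜 := ℂ) (L' ω) p.1)).re} := by
    intro ω hω
    by_contra hcon
    simp only [Set.mem_iUnion, Finset.mem_product, not_exists] at hcon
    refine absurd (opNorm_le_of_net hN (L' ω) hs fun x hx y hy => ?_) (not_le.2 hω)
    exact (not_le.1 (hcon (x, y) ⟨hx, hy⟩)).le
  calc μ.real {ω | 4 * s < opNorm (L' ω)}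
      ≤ μ.real (⋃ p ∈ N ×ˢ N, {ω | s ≤ (inner ℂ p.2
          (Matrix.toEuclideanCLM (n := Fin d) (𝕜 := ℂ) (L' ω) p.1)).re}) :=
        measureReal_mono hsub (measure_ne_top _ _)
    _ ≤ ∑ p ∈ N ×ˢ N, μ.real {ω | s ≤ (inner ℂ p.2
          (Matrix.toEuclideanCLM (n := Fin d) (𝕜 := ℂ) (L' ω) p.1)).re} :=
        measureReal_biUnion_finset_le _ _
    _ ≤ ∑ p ∈ N ×ˢ N, Real.exp (-s ^ 2 / (4 * κ ^ 2)) := Finset.sum_le_sum fun p hp =>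
        measure_re_inner_ge_le hind h0 hL (hN1 _ (Finset.mem_product.1 hp).1)
          (hN1 _ (Finset.mem_product.1 hp).2) hs
    _ = (N.card * N.card : ℕ) * Real.exp (-s ^ 2 / (4 * κ ^ 2)) := by
        rw [Finset.sum_const, Finset.card_product, nsmul_eq_mul]
    _ ≤ Real.exp (8 * d) * Real.exp (-s ^ 2 / (4 * κ ^ 2)) := by
        refine mul_le_mul_of_nonneg_right ?_ (Real.exp_pos _).le
        have h5 : (5 : ℝ) ≤ Real.exp 2 := by
          have := Real.quadratic_le_exp_of_nonneg (x := 2) (by norm_num)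
          linarith
        calc ((N.card * N.card : ℕ) : ℝ) ≤ ((5 ^ (2 * d) * 5 ^ (2 * d) : ℕ) : ℝ) := by
              exact_mod_cast Nat.mul_le_mul hNc hNc
          _ = (5 : ℝ) ^ (4 * d) := by
              push_cast
              rw [← pow_add]
              congr 1
              ring
          _ ≤ Real.exp 2 ^ (4 * d) := by gcongr
          _ = Real.exp (8 * d) := by
              rw [← Real.exp_nat_mul]
              congr 1
              push_cast
              ring
    _ = _ := by
        rw [← Real.exp_add]
        congr 1
        ring

/-- The lower tail of the Frobenius norm. -/
lemma measure_frobNorm_sq_le_le (hind : iIndepFun (fun (p : Fin d × Fin d) ω => L' ω p.1 p.2) μ)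
    (h1 : ∀ i j, ∫ ω, ‖L' ω i j‖ ^ 2 ∂μ = 1) (hκ : 0 < κ)
    (hL : ∀ i j, ExpSqMoment μ (fun ω => L' ω i j) κ) :
    μ.real {ω | frobNorm (L' ω) ^ 2 ≤ (d : ℝ) ^ 2 / 2} ≤
      Real.exp (-((d : ℝ) ^ 2 / (64 * κ ^ 4))) := by
  -- With this `θ`, the quadratic term of the Laplace transform is a quarter of the linear one.
  set θ : ℝ := 1 / (16 * κ ^ 4) with hθ
  have hθ0 : 0 < θ := by positivity
  have hind' : iIndepFun (fun (p : Fin d × Fin d) ω => ‖L' ω p.1 p.2‖ ^ 2) μ :=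
    hind.comp (fun _ w => ‖w‖ ^ 2) fun _ => by fun_prop
  have hm : ∀ p : Fin d × Fin d, Measurable fun ω => ‖L' ω p.1 p.2‖ ^ 2 := fun p => by
    have := (hL p.1 p.2).measurable
    fun_prop
  have hsum : ∀ ω, frobNorm (L' ω) ^ 2 = (∑ p : Fin d × Fin d, fun ω => ‖L' ω p.1 p.2‖ ^ 2) ω :=
    fun ω => by rw [frobNorm_sq, Finset.sum_apply, Fintype.sum_prod_type]
  simp only [hsum]
  refine (measure_le_le_exp_mul_mgf ((d : ℝ) ^ 2 / 2) (neg_nonpos.2 hθ0.le) ?_).trans ?_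
  · have hms : Measurable (∑ p : Fin d × Fin d, fun ω => ‖L' ω p.1 p.2‖ ^ 2) := by
      rw [show (∑ p : Fin d × Fin d, fun ω => ‖L' ω p.1 p.2‖ ^ 2) =
        fun ω => ∑ p : Fin d × Fin d, ‖L' ω p.1 p.2‖ ^ 2 from
          funext fun ω => Finset.sum_apply _ _ _]
      exact Finset.measurable_sum _ fun p _ => hm p
    refine Integrable.of_bound (C := 1) (by fun_prop) (Filter.Eventually.of_forall fun ω => ?_)
    rw [Real.norm_of_nonneg (Real.exp_pos _).le, Real.exp_le_one_iff, ← hsum]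
    nlinarith [sq_nonneg (frobNorm (L' ω))]
  · rw [hind'.mgf_sum hm]
    have h2 : ∏ p : Fin d × Fin d, mgf (fun ω => ‖L' ω p.1 p.2‖ ^ 2) μ (-θ) ≤
        Real.exp (-θ + 4 * κ ^ 4 * θ ^ 2) ^ (d ^ 2) := by
      refine (Finset.prod_le_prod (fun p _ => mgf_nonneg)
        fun p _ => (hL p.1 p.2).mgf_sq_le (h1 p.1 p.2) hθ0.le).trans (le_of_eq ?_)
      rw [Finset.prod_const, Finset.card_univ, Fintype.card_prod, Fintype.card_fin, ← sq d]
    refine (mul_le_mul_of_nonneg_left h2 (Real.exp_pos _).le).trans (le_of_eq ?_)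
    rw [← Real.exp_nat_mul, ← Real.exp_add]
    congr 1
    rw [hθ]
    push_cast
    field_simp
    ring

lemma opNorm_smul (r : ℝ) (A : Matrix (Fin d) (Fin d) ℂ) :
    opNorm ((r : ℂ) • A) = |r| * opNorm A := by
  rw [opNorm, map_smul, norm_smul, Complex.norm_real, Real.norm_eq_abs]
  rfl

lemma opNorm_sq_normalization_le (h : IsNormalization L' L) {ω : Ω} {s : ℝ} (hd : 0 < d)
    (h1 : opNorm (L' ω) ≤ 4 * s) (h2 : (d : ℝ) ^ 2 / 2 < frobNorm (L' ω) ^ 2) :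
    opNorm (L ω) ^ 2 ≤ 32 * s ^ 2 / (d : ℝ) ^ 2 := by
  have hd0 : (0 : ℝ) < d := by exact_mod_cast hd
  have hne : L' ω ≠ 0 := fun h => by
    rw [h] at h2
    have : (0 : ℝ) < (d : ℝ) ^ 2 / 2 := by positivity
    simp [frobNorm] at h2
    linarith
  rw [h.eq_div ω hne, opNorm_smul, mul_pow, sq_abs, div_pow, one_pow, one_div, inv_mul_eq_div]
  have h3 := pow_le_pow_left₀ (opNorm_nonneg _) h1 2
  have hpos : 0 < (d : ℝ) ^ 2 / 2 := by positivity
  calc opNorm (L' ω) ^ 2 / frobNorm (L' ω) ^ 2 ≤ (4 * s) ^ 2 / ((d : ℝ) ^ 2 / 2) := by gcongr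
    _ = 32 * s ^ 2 / (d : ℝ) ^ 2 := by
      field_simp
      ring

/-- Concentration of the operator norm of the normalized matrix. If `δ` is so small that the lower
tail of the Frobenius norm is not negligible, the bound exceeds the trivial bound `1`. -/
lemma measure_opNorm_sq_le_ge (h' : IsSubgaussianEnsemble μ L' K) (h : IsNormalization L' L)
    (hd : 0 < d) {δ : ℝ} (hδ : 0 < δ) (hδ1 : δ < 1) :
    ENNReal.ofReal (1 - δ) ≤ μ {ω | opNorm (L ω) ^ 2 ≤
      (1152 * (max K 0 + 1) ^ 2 + 64 * (max K 0 + 1) ^ 4) *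
        (1 / (d : ℝ) + Real.log (1 / δ) / (d : ℝ) ^ 2)} := by
  set κ := max K 0 + 1 with hκdef
  have hκ : 0 < κ := by have := le_max_right K 0; linarith
  have hd1 : (1 : ℝ) ≤ d := by exact_mod_cast hd
  set l := Real.log (1 / δ) with hl
  have hl0 : 0 < l := Real.log_pos (by rw [lt_div_iff₀ hδ]; linarith)
  have hexp : Real.exp (-l) = δ := by
    rw [hl, one_div, Real.log_inv, neg_neg, Real.exp_log hδ]
  have hrw : 1 / (d : ℝ) + l / (d : ℝ) ^ 2 = (d + l) / (d : ℝ) ^ 2 := by field_simp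
  have hlog2 : Real.log 2 ≤ 1 := by
    have := Real.log_two_lt_d9
    linarith
  rw [hrw]
  rcases le_or_gt (Real.exp (-((d : ℝ) ^ 2 / (64 * κ ^ 4)))) (δ / 2) with hcase | hcase
  -- This `s` makes the bound on the upper tail equal to `δ / e`.
  · set s := Real.sqrt (4 * κ ^ 2 * (8 * d + 1 + l)) with hs
    have hs2 : s ^ 2 = 4 * κ ^ 2 * (8 * d + 1 + l) := Real.sq_sqrt (by positivity)
    have hb1 := measure_opNorm_gt_le h'.indep h'.mean_zero h'.expSqMoment
      (Real.sqrt_nonneg (4 * κ ^ 2 * (8 * d + 1 + l)))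
    have hb2 := (measure_frobNorm_sq_le_le h'.indep h'.unit_variance hκ h'.expSqMoment).trans hcase
    rw [← hs, ← hκdef, hs2] at hb1
    have he : Real.exp (8 * d - 4 * κ ^ 2 * (8 * d + 1 + l) / (4 * κ ^ 2)) ≤ δ / 2 := by
      have : 8 * (d : ℝ) - 4 * κ ^ 2 * (8 * d + 1 + l) / (4 * κ ^ 2) = -l + -1 := by
        rw [mul_div_cancel_left₀ _ (by positivity)]
        ring
      rw [this, Real.exp_add, hexp, div_eq_mul_inv, Real.exp_neg]
      gcongr
      have := Real.add_one_le_exp 1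
      linarith
    have hb1 := hb1.trans he
    set S := {ω | opNorm (L ω) ^ 2 ≤ (1152 * κ ^ 2 + 64 * κ ^ 4) * ((d + l) / (d : ℝ) ^ 2)} with hS
    set B1 := {ω | 4 * s < opNorm (L' ω)}
    set B2 := {ω | frobNorm (L' ω) ^ 2 ≤ (d : ℝ) ^ 2 / 2}
    have hcover : Set.univ ⊆ S ∪ (B1 ∪ B2) := fun ω _ => by
      by_contra hcon
      simp only [Set.mem_union, not_or] at hcon
      obtain ⟨hcS, hc1, hc2⟩ := hcon
      refine hcS ((opNorm_sq_normalization_le h hd (not_lt.1 hc1) (not_le.1 hc2)).trans ?_)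
      rw [hs2, mul_div_assoc']
      refine div_le_div_of_nonneg_right ?_ (by positivity)
      have : 0 ≤ 64 * κ ^ 4 * (d + l) := by positivity
      nlinarith [mul_nonneg (sq_nonneg κ) hl0.le, mul_nonneg (sq_nonneg κ) (sub_nonneg.2 hd1)]
    have hreal : 1 ≤ μ.real S + (μ.real B1 + μ.real B2) := by
      have h1 : μ.real Set.univ ≤ μ.real (S ∪ (B1 ∪ B2)) :=
        measureReal_mono hcover (measure_ne_top _ _)
      rw [probReal_univ] at h1
      exact h1.trans ((measureReal_union_le _ _).trans
        (add_le_add_right (measureReal_union_le _ _) _))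
    rw [← ENNReal.ofReal_toReal (measure_ne_top μ S)]
    refine ENNReal.ofReal_le_ofReal ?_
    change 1 - δ ≤ μ.real S
    linarith
  -- Here `d² / (64 κ⁴) ≤ d + log (1 / δ)`, and the bound is at least `1`.
  · have hall : ∀ ω, opNorm (L ω) ^ 2 ≤
        (1152 * κ ^ 2 + 64 * κ ^ 4) * ((d + l) / (d : ℝ) ^ 2) := fun ω => by
      have h1 : opNorm (L ω) ^ 2 ≤ 1 :=
        pow_le_one₀ (opNorm_nonneg _) (h.normalized ω ▸ opNorm_le_frobNorm (L ω))
      refine h1.trans ?_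
      have h2 : Real.log (δ / 2) < -((d : ℝ) ^ 2 / (64 * κ ^ 4)) := by
        rwa [Real.log_lt_iff_lt_exp (by positivity)]
      rw [Real.log_div hδ.ne' two_ne_zero] at h2
      have h3 : Real.log δ = -l := by rw [hl, one_div, Real.log_inv, neg_neg]
      have h4 : (d : ℝ) ^ 2 / (64 * κ ^ 4) ≤ d + l := by linarith
      rw [div_le_iff₀ (by positivity)] at h4
      rw [mul_div_assoc', le_div_iff₀ (by positivity), one_mul]
      have : 0 ≤ 1152 * κ ^ 2 * (d + l) := by positivity
      linarith
    rw [show {ω | opNorm (L ω) ^ 2 ≤ (1152 * κ ^ 2 + 64 * κ ^ 4) * ((d + l) / (d : ℝ) ^ 2)} =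
      Set.univ from Set.eq_univ_of_forall hall, measure_univ]
    exact ENNReal.ofReal_le_one.2 (by linarith)

omit [IsProbabilityMeasure μ] in
lemma measure_mul_opNorm_sq_le_ge (hd : 0 < d) {x y δ : ℝ} (h : ENNReal.ofReal (1 - δ) ≤
      μ {ω | opNorm (L ω) ^ 2 ≤ x * (1 / (d : ℝ) + y / (d : ℝ) ^ 2)}) :
    ENNReal.ofReal (1 - δ) ≤ μ {ω | d * opNorm (L ω) ^ 2 ≤ x * (1 + y / d)} := by
  refine h.trans (measure_mono fun ω hω => ?_)
  have hd0 : (0 : ℝ) < d := by exact_mod_cast hd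
  have hω : opNorm (L ω) ^ 2 ≤ x * (1 / (d : ℝ) + y / (d : ℝ) ^ 2) := hω
  refine (mul_le_mul_of_nonneg_left hω hd0.le).trans (le_of_eq ?_)
  field_simp

end Ensemble

end WML


theorem theorem4 (K : ℝ) :
    ∃ C : ℝ, 0 < C ∧
      -- concentration of the normalized operator norm, and the bound on the sample complexity
      (∀ (d : ℕ), 2 ≤ d → ∀ (Ω : Type*) [MeasurableSpace Ω] (μ : Measure Ω)
        [IsProbabilityMeasure μ] (L' L : Ω → Matrix (Fin d) (Fin d) ℂ),
        WML.IsSubgaussianEnsemble μ L' K → WML.IsNormalization L' L →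
        ∀ δ : ℝ, 0 < δ → δ < 1 →
          ENNReal.ofReal (1 - δ) ≤ μ {ω | WML.opNorm (L ω) ^ 2 ≤
            C * (1 / (d : ℝ) + Real.log (1 / δ) / (d : ℝ) ^ 2)} ∧
          ∀ t ε : ℝ, 0 ≤ t → 0 < ε → ε < 1 →
            WML.typicalSampleComplexity μ L t ε δ ≤
              (⌈C * (t ^ 2 / ε) * (1 + Real.log (1 / δ) / (d : ℝ))⌉₊ : ℕ∞) ∧
            WML.typicalWMLComplexity μ L t ε δ ≤
              (⌈C * (t ^ 2 / ε) * (1 + Real.log (1 / δ) / (d : ℝ))⌉₊ : ℕ∞)) ∧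
      -- for fixed `K` and `δ` and large `d`, the sample complexity is `O(t² / ε)`
      (∀ δ : ℝ, 0 < δ → δ < 1 → ∃ d₀ : ℕ, ∀ (d : ℕ), 2 ≤ d → d₀ ≤ d →
        ∀ (Ω : Type*) [MeasurableSpace Ω] (μ : Measure Ω) [IsProbabilityMeasure μ]
          (L' L : Ω → Matrix (Fin d) (Fin d) ℂ),
        WML.IsSubgaussianEnsemble μ L' K → WML.IsNormalization L' L →
        ∀ t ε : ℝ, 0 ≤ t → 0 < ε → ε < 1 →
          WML.typicalSampleComplexity μ L t ε δ ≤ (⌈C * (t ^ 2 / ε)⌉₊ : ℕ∞) ∧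
          WML.typicalWMLComplexity μ L t ε δ ≤ (⌈C * (t ^ 2 / ε)⌉₊ : ℕ∞)) := by
  have hκ : 0 < max K 0 + 1 := by have := le_max_right K 0; linarith
  set C₀ : ℝ := 1152 * (max K 0 + 1) ^ 2 + 64 * (max K 0 + 1) ^ 4 with hC₀
  have hC₀pos : 0 < C₀ := by positivity
  have hpos : ∀ δ : ℝ, 0 < δ → δ < 1 → 0 < Real.log (1 / δ) := fun δ h0 h1 =>
    Real.log_pos (by rw [lt_div_iff₀ h0]; linarith)
  -- The factor `5` covers `9 / 4` from the error of the algorithm, times `1 + log (1 / δ) / d ≤ 2`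
  -- in the last part.
  refine ⟨5 * C₀, by positivity, fun d hd Ω _ μ _ L' L h' h δ hδ hδ1 =>
    ⟨?_, fun t ε ht hε _ => ?_⟩,
    fun δ hδ hδ1 => ⟨⌈Real.log (1 / δ)⌉₊, fun d hd hd₀ Ω _ μ _ L' L h' h t ε ht hε _ => ?_⟩⟩
  · refine (WML.measure_opNorm_sq_le_ge h' h (by omega) hδ hδ1).trans
      (measure_mono fun ω hω => le_trans (b := C₀ * (1 / (d : ℝ) + Real.log (1 / δ) / (d : ℝ) ^ 2))
        hω ?_)
    have := hpos δ hδ hδ1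
    gcongr
    linarith
  · have hd0 : 0 < d := by omega
    have hl := hpos δ hδ hδ1
    refine WML.sampleComplexities_le hd0 h.normalized ht hε (WML.measure_mul_opNorm_sq_le_ge hd0
      (WML.measure_opNorm_sq_le_ge h' h hd0 hδ hδ1)) (le_trans ?_ (Nat.le_ceil _))
    rw [← hC₀]
    have : 0 ≤ C₀ * (1 + Real.log (1 / δ) / d) * (t ^ 2 / ε) := by positivity
    linarith
  · have hd0 : 0 < d := by omega
    have hl : Real.log (1 / δ) / d ≤ 1 := by
      rw [div_le_one (by exact_mod_cast hd0)]
      exact (Nat.le_ceil _).trans (by exact_mod_cast hd₀)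
    refine WML.sampleComplexities_le hd0 h.normalized ht hε (WML.measure_mul_opNorm_sq_le_ge hd0
      (WML.measure_opNorm_sq_le_ge h' h hd0 hδ hδ1)) (le_trans ?_ (Nat.le_ceil _))
    rw [← hC₀]
    have h1 : 9 / 4 * (C₀ * (1 + Real.log (1 / δ) / d)) ≤ 5 * C₀ := by nlinarith
    exact mul_le_mul_of_nonneg_right h1 (by positivity)
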